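/- Let $r\ge 1$ and let $\vec a,\vec b\in(-1,\infty)^r$ with $a_j\le b_j$ for all $j$. For $a<b$ let $\mathcal B^{a,b}(x)=x^{a}(1-x)^{b-a-1}/\Gamma(b-a)$ on $(0,1)$, extended by zero. Let $w_0(\,\cdot\,;\vec a,\vec b)$ be the Mellin convolution of the densities $\mathcal B^{a_i,b_i}$, $1\le i\le r$, where $(f\ast g)(x)=\int_0^\infty f(t)g(x/t)\,\frac{dt}{t}$ and indices with $a_i=b_i$ (whose factor is the unit of the convolution) are omitted. Put $w_j(x)=w_0(x;\vec a,\vec b+\vec e_j)$ for $1\le j\le r$, so that $\int_0^1x^{s-1}w_j(x)\,dx=\prod_{i=1}^r\frac{\Gamma(s+a_i)}{\Gamma(s+b_i+\delta_{i,j})}$. A multi-index $\vec n\in\mathbb Z_{\ge0}^r$, of size $|\vec n|=n_1+\dots+n_r$, is near the diagonal if $|n_i-n_j|\le1$ for all $i,j$. The weights $\{w_j\}_{j=1}^r$ form an AT-system on $(0,1)$ for $\vec n$ if every function $F=\sum_{j=1}^rA_jw_j$, with real polynomials $A_j$ of degree at most $n_j-1$ (so $A_j=0$ if $n_j=0$),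 that is not identically zero on $(0,1)$ has at most $|\vec n|-1$ zeros in $(0,1)$. (i) Let $\vec n$ be near the diagonal and suppose that $b_j-a_j\in\mathbb Z_{\ge0}\cup(|\vec n|-1,\infty)$ for all $j$. Suppose moreover that $b_i-b_j\notin\mathbb Z$ whenever $i\ne j$, or that $b_J-a_J>|\vec n|-n_J$ for some $J$. Then $\{w_j\}_{j=1}^r$ is an AT-system on $(0,1)$ for $\vec n$. (ii) Suppose that $b_j-a_j\in\mathbb Z_{\ge0}$ for all $j$ and $b_i-b_j\notin\mathbb Z$ whenever $i\ne j$. Then for every multi-index $\vec n$ near the diagonal, $\{w_j\}_{j=1}^r$ is an AT-system on $(0,1)$ for $\vec n$, and the functions $x^kw_j(x)$, $0\le k\le n_j-1$, $1\le j\le r$, are linearly independent on $(0,1)$; that is, every $F=\sum_jA_jw_j$ as above with $A_1,\dots,A_r$ not all zero has at most $|\vec n|-1$ zeros in $(0,1)$. -/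

import Mathlib

open scoped Polynomial

noncomputable section

namespace JacobiLike

/-- The beta density `x ^ a * (1 - x) ^ (b - a - 1) / Γ (b - a)` on `(0, 1)`, extended by zero;
for `a < b` its Mellin transform is `Γ (s + a) / Γ (s + b)`. -/
def betaDensity (a b x : ℝ) : ℝ :=
  if 0 < x ∧ x < 1 then x ^ a * (1 - x) ^ (b - a - 1) / Real.Gamma (b - a) else 0

/-- The Mellin convolution `(f ∗ g)(x) = ∫₀^∞ f(t) g(x / t) dt / t`. -/
def mellinConv (f g : ℝ → ℝ) (x : ℝ) : ℝ :=
  ∫ t in Set.Ioi (0 : ℝ), f t * g (x / t) / t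

/-- The Mellin convolution of the beta densities whose parameter pairs `(a, b)` are listed.
The empty convolution is a point mass at `1`, not a function; the value `0` is a placeholder. -/
def betaConv : List (ℝ × ℝ) → ℝ → ℝ
  | [] => 0
  | [p] => betaDensity p.1 p.2
  | p :: q :: l => mellinConv (betaDensity p.1 p.2) (betaConv (q :: l))

/-- The weight `w₀(x; a, b)` with Mellin transform `∏ᵢ Γ(s + aᵢ) / Γ(s + bᵢ)`: the Mellin
convolution of the beta densities with parameters `(aᵢ, bᵢ)`. An index with `aᵢ = bᵢ`
contributes the factor `1` to the Mellin transform and is left out of the convolution. -/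
def baseWeight {r : ℕ} (a b : Fin r → ℝ) : ℝ → ℝ :=
  betaConv ((List.ofFn fun i => (a i, b i)).filter fun p => p.1 ≠ p.2)

/-- The weights `wⱼ(x; a, b) = w₀(x; a, b + eⱼ)`. -/
def weight {r : ℕ} (a b : Fin r → ℝ) (j : Fin r) : ℝ → ℝ :=
  baseWeight a (b + Pi.single j 1)

/-- The multi-index `n` is near the diagonal: `|nᵢ - nⱼ| ≤ 1` for all `i`, `j`. -/
def NearDiagonal {r : ℕ} (n : Fin r → ℕ) : Prop :=
  ∀ i j, |(n i : ℤ) - (n j : ℤ)| ≤ 1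

/-- The polynomial combination `F(x) = ∑ⱼ Aⱼ(x) wⱼ(x)`. -/
def polyComb {r : ℕ} (w : Fin r → ℝ → ℝ) (A : Fin r → ℝ[X]) (x : ℝ) : ℝ :=
  ∑ j, (A j).eval x * w j x

/-- `w` is an AT-system on `I` for the multi-index `n`: every non-zero function
`F = ∑ⱼ Aⱼ wⱼ` with `deg Aⱼ ≤ nⱼ - 1` (and `Aⱼ = 0` if `nⱼ = 0`) has at most `|n| - 1` zeros
in `I`. -/
def IsATSystem {r : ℕ} (w : Fin r → ℝ → ℝ) (I : Set ℝ) (n : Fin r → ℕ) : Prop :=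
  ∀ A : Fin r → ℝ[X], (∀ j, A j ∈ Polynomial.degreeLT ℝ (n j)) →
    (∃ x ∈ I, polyComb w A x ≠ 0) →
    {x ∈ I | polyComb w A x = 0}.encard < ((∑ j, n j : ℕ) : ℕ∞)

/-- The functions `x ^ k * wⱼ(x)`, `0 ≤ k ≤ nⱼ - 1`, are linearly independent on `I`: a
combination `∑ⱼ Aⱼ wⱼ` whose polynomials are not all zero is not identically zero on `I`. -/
def IsIndependentSystem {r : ℕ} (w : Fin r → ℝ → ℝ) (I : Set ℝ) (n : Fin r → ℕ) : Prop :=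
  ∀ A : Fin r → ℝ[X], (∀ j, A j ∈ Polynomial.degreeLT ℝ (n j)) → A ≠ 0 →
    ∃ x ∈ I, polyComb w A x ≠ 0

end JacobiLike

end

open scoped Polynomial

namespace JacobiLike

open MeasureTheory Set Filter Topology

noncomputable section

/-! On the Mellin side, convolution with `betaDensity a b` is multiplication by Γ(s+a)/Γ(s+b), and
convolution with x^β is multiplication by 1/(s+β). Writing T for the product of the operators
`betaOp (a i) (b i)` and P_β for `powOp β`, the functional equation of Γ gives w_j = T(x^{b_j}),
with the same T for all j (`weight_eq`). Multiplication by x shifts s by 1, so x^k w_j = T(S_k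
x^{b_j+k}), where S_k is the product of the operators 1 - (b_i - a_i) P_{b_i+l} over all i and all l
< k (`pow_mul_weight`). Hence F = T(g) for an explicit g (`eulerComb`).

Near the diagonal, g solves an Euler equation of order |n| with exponents b_i + l, l < n_i
(`eulerComb_mem`). If g ≠ 0, Rolle's theorem gives it at most |n| - 1 zeros
(`encard_zeros_lt_length`). It remains to see that T creates no zeros. A factor of integer order is
a composition of weighted primitives vanishing at 1, which is again Rolle. A factor of real order
exceeding the number of sign changes is variation diminishing (`encard_zeros_betaOp_le_card`).

If F is not identically zero then g ≠ 0, which gives the AT property. For independence, g ≠ 0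
follows from A ≠ 0 by inspecting the coefficient of a power of top degree (`eulerComb_ne_zero`). -/

/-! ### Mellin convolution as an operator on functions on (0, 1). -/

/-- A convolution kernel on `(0, 1)`: integrable away from the origin. -/
structure IsKernel (k : ℝ → ℝ) : Prop where
  zero_off : ∀ x, x ∉ Ioo (0 : ℝ) 1 → k x = 0
  measurable : Measurable k
  integrableOn : ∀ δ, 0 < δ → IntegrableOn k (Ioi δ)

/-- The functions supported in `(0, 1)`, continuous there and bounded away from the origin. -/
def tame : Submodule ℝ (ℝ → ℝ) where
  carrier := {f | (∀ x, x ∉ Ioo (0 : ℝ) 1 → f x = 0) ∧ ContinuousOn f (Ioo 0 1) ∧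
    ∀ δ, 0 < δ → ∃ C, 0 ≤ C ∧ ∀ x, δ ≤ x → |f x| ≤ C}
  add_mem' := by
    rintro f g ⟨hf, hfc, hfb⟩ ⟨hg, hgc, hgb⟩
    refine ⟨fun x hx => by simp [hf x hx, hg x hx], hfc.add hgc, fun δ hδ => ?_⟩
    obtain ⟨C, hC, hCf⟩ := hfb δ hδ
    obtain ⟨D, hD, hDg⟩ := hgb δ hδ
    exact ⟨C + D, by positivity, fun x hx =>
      (abs_add_le _ _).trans (add_le_add (hCf x hx) (hDg x hx))⟩
  zero_mem' := ⟨fun _ _ => rfl, continuousOn_const, fun _ _ => ⟨0, le_rfl, fun _ _ => by simp⟩⟩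
  smul_mem' := by
    rintro c f ⟨hf, hfc, hfb⟩
    refine ⟨fun x hx => by simp [hf x hx], hfc.const_smul c, fun δ hδ => ?_⟩
    obtain ⟨C, hC, hCf⟩ := hfb δ hδ
    refine ⟨|c| * C, by positivity, fun x hx => ?_⟩
    simpa [abs_mul] using mul_le_mul_of_nonneg_left (hCf x hx) (abs_nonneg c)

theorem tame.zero_off {f : ℝ → ℝ} (hf : f ∈ tame) {x : ℝ} (hx : x ∉ Ioo (0 : ℝ) 1) : f x = 0 :=
  hf.1 x hx

theorem tame.continuousOn {f : ℝ → ℝ} (hf : f ∈ tame) : ContinuousOn f (Ioo 0 1) := hf.2.1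

theorem tame.bounded {f : ℝ → ℝ} (hf : f ∈ tame) {δ : ℝ} (hδ : 0 < δ) :
    ∃ C, 0 ≤ C ∧ ∀ x, δ ≤ x → |f x| ≤ C := hf.2.2 δ hδ

theorem measurable_of_continuousOn_Ioo {f : ℝ → ℝ} (h0 : ∀ x, x ∉ Ioo (0 : ℝ) 1 → f x = 0)
    (hc : ContinuousOn f (Ioo 0 1)) : Measurable f := by
  classical
  have h : f = (Ioo (0 : ℝ) 1).piecewise f 0 := by
    ext x
    by_cases hx : x ∈ Ioo (0 : ℝ) 1
    · rw [piecewise_eq_of_mem _ _ _ hx]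
    · rw [piecewise_eq_of_notMem _ _ _ hx, h0 x hx]; rfl
  rw [h]
  exact hc.measurable_piecewise continuousOn_const measurableSet_Ioo

theorem tame.measurable {f : ℝ → ℝ} (hf : f ∈ tame) : Measurable f :=
  measurable_of_continuousOn_Ioo hf.1 hf.2.1

theorem tame.isKernel {f : ℝ → ℝ} (hf : f ∈ tame) : IsKernel f := by
  refine ⟨hf.1, tame.measurable hf, fun δ hδ => ?_⟩
  obtain ⟨C, hC, hCf⟩ := tame.bounded hf hδ
  have h1 : Integrable (indicator (Ioo (0 : ℝ) 1) fun _ => C) (volume.restrict (Ioi δ)) :=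
    ((integrable_indicator_iff measurableSet_Ioo).2
      (integrableOn_const (by simp))).restrict
  refine h1.mono' (tame.measurable hf).aestronglyMeasurable ?_
  refine (ae_restrict_iff' measurableSet_Ioi).2 (Eventually.of_forall fun x hx => ?_)
  by_cases h : x ∈ Ioo (0 : ℝ) 1
  · rw [indicator_of_mem h]; exact hCf x (le_of_lt hx)
  · rw [indicator_of_notMem h, hf.1 x h]; simp

/-- A uniform bound for the integrand of a Mellin convolution. -/
theorem abs_mellinConv_integrand_le {k f : ℝ → ℝ} (hk : IsKernel k)
    (hf : ∀ x, x ∉ Ioo (0 : ℝ) 1 → f x = 0) {δ C : ℝ} (hδ : 0 < δ) (hC : 0 ≤ C)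
    (hCf : ∀ x, δ ≤ x → |f x| ≤ C) {x : ℝ} (hx : δ ≤ x) (t : ℝ) :
    |k t * f (x / t) / t| ≤ C / δ * indicator (Ioi δ) (fun t => |k t|) t := by
  have hR : 0 ≤ C / δ * indicator (Ioi δ) (fun t => |k t|) t :=
    mul_nonneg (by positivity) (indicator_nonneg (fun _ _ => abs_nonneg _) _)
  by_cases ht : t ∈ Ioo (0 : ℝ) 1
  · by_cases hxt : x / t < 1
    · have htx : x < t := by rwa [div_lt_one ht.1] at hxt
      have hδt : δ < t := hx.trans_lt htx
      rw [indicator_of_mem (show t ∈ Ioi δ from hδt), abs_div, abs_mul, abs_of_pos ht.1]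
      have h1 : |f (x / t)| ≤ C := hCf _ (hx.trans (by
        rw [le_div_iff₀ ht.1]; nlinarith [ht.2, hδ.trans_le hx]))
      calc |k t| * |f (x / t)| / t ≤ |k t| * C / δ := by gcongr
        _ = _ := by ring
    · rw [hf _ (fun h => hxt h.2)]; simpa using hR
  · rw [hk.zero_off t ht]; simpa using hR

theorem IsKernel.integrable_indicator {k : ℝ → ℝ} (hk : IsKernel k) {δ : ℝ} (hδ : 0 < δ) :
    Integrable (indicator (Ioi δ) fun t => |k t|) :=
  (integrable_indicator_iff measurableSet_Ioi).2 (hk.integrableOn δ hδ).abs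

theorem measurable_mellinConv_integrand {k f : ℝ → ℝ} (hk : Measurable k) (hf : Measurable f)
    (x : ℝ) : Measurable fun t => k t * f (x / t) / t :=
  (hk.mul (hf.comp (measurable_const.div measurable_id))).div measurable_id

theorem integrable_mellinConv_integrand {k f : ℝ → ℝ} (hk : IsKernel k) (hf : f ∈ tame)
    {x : ℝ} (hx : 0 < x) : Integrable fun t => k t * f (x / t) / t := by
  obtain ⟨C, hC, hCf⟩ := tame.bounded hf hx
  refine ((hk.integrable_indicator hx).const_mul (C / x)).mono'
    (measurable_mellinConv_integrand hk.measurable (tame.measurable hf) x).aestronglyMeasurable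
    (Eventually.of_forall fun t => ?_)
  exact abs_mellinConv_integrand_le hk hf.1 hx hC hCf le_rfl t

theorem mellinConv_zero_off {k f : ℝ → ℝ} (hk : ∀ x, x ∉ Ioo (0 : ℝ) 1 → k x = 0)
    (hf : ∀ x, x ∉ Ioo (0 : ℝ) 1 → f x = 0) {x : ℝ} (hx : x ∉ Ioo (0 : ℝ) 1) :
    mellinConv k f x = 0 := by
  have : ∀ t, t ∈ Ioi (0 : ℝ) → k t * f (x / t) / t = 0 := by
    intro t ht
    have ht : 0 < t := ht
    by_cases h1 : t < 1
    · rw [hf (x / t), mul_zero, zero_div]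
      rintro ⟨h2, h3⟩
      rw [div_lt_one ht] at h3
      exact hx ⟨by simpa [ht] using (div_pos_iff_of_pos_right ht).1 h2, h3.trans h1⟩
    · rw [hk t fun h => h1 h.2]; simp
  rw [mellinConv, setIntegral_congr_fun measurableSet_Ioi this]
  simp

theorem mellinConv_mem_tame {k f : ℝ → ℝ} (hk : IsKernel k) (hf : f ∈ tame) :
    mellinConv k f ∈ tame := by
  refine ⟨fun x hx => mellinConv_zero_off hk.zero_off hf.1 hx, fun x₀ hx₀ => ?_, fun δ hδ => ?_⟩
  · refine ContinuousAt.continuousWithinAt ?_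
    have hδ : 0 < x₀ / 2 := half_pos hx₀.1
    obtain ⟨C, hC, hCf⟩ := tame.bounded hf hδ
    refine continuousAt_of_dominated
      (bound := fun t => C / (x₀ / 2) * indicator (Ioi (x₀ / 2)) (fun t => |k t|) t)
      (Eventually.of_forall fun x => (measurable_mellinConv_integrand hk.measurable
        (tame.measurable hf) x).aestronglyMeasurable) ?_
      ((hk.integrable_indicator hδ).const_mul _).restrict ?_
    · filter_upwards [Ioi_mem_nhds (half_lt_self hx₀.1)] with x hx
      exact Eventually.of_forall fun t =>
        abs_mellinConv_integrand_le hk hf.1 hδ hC hCf (le_of_lt hx) t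
    -- Functions in `tame` may jump at 1, so continuity of the integrand in x fails at most for the
    -- single value t = x₀.
    · have hne : ∀ᵐ t : ℝ, t ≠ x₀ := by simp [ae_iff, measure_singleton]
      refine (ae_restrict_iff' measurableSet_Ioi).2 ?_
      filter_upwards [hne] with t ht ht0
      have ht0 : 0 < t := ht0
      have hfc : ContinuousAt f (x₀ / t) := by
        rcases lt_or_gt_of_ne ht with h | h
        · have h1 : 1 < x₀ / t := by rwa [one_lt_div ht0]
          have : f =ᶠ[𝓝 (x₀ / t)] fun _ => 0 := by
            filter_upwards [Ioi_mem_nhds h1] with y hy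
            exact hf.1 y fun h => not_lt.2 h.2.le hy
          exact (continuousAt_const).congr this.symm
        · exact hf.2.1.continuousAt (Ioo_mem_nhds (div_pos hx₀.1 ht0) (by rwa [div_lt_one ht0]))
      have : ContinuousAt (fun x => f (x / t)) x₀ :=
        ContinuousAt.comp (f := fun x : ℝ => x / t) hfc (by fun_prop)
      exact (continuousAt_const.mul this).div_const t
  · obtain ⟨C, hC, hCf⟩ := tame.bounded hf hδ
    refine ⟨∫ t in Ioi 0, C / δ * indicator (Ioi δ) (fun t => |k t|) t, ?_, fun x hx => ?_⟩
    · exact integral_nonneg fun t =>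
        mul_nonneg (by positivity) (indicator_nonneg (fun _ _ => abs_nonneg _) _)
    · rw [← Real.norm_eq_abs, mellinConv]
      exact norm_integral_le_of_norm_le ((hk.integrable_indicator hδ).const_mul _).restrict
        (Eventually.of_forall fun t => abs_mellinConv_integrand_le hk hf.1 hδ hC hCf hx t)

/-- The substitution t = x/u preserves dt/t. It is carried out as an inversion followed by a
scaling. -/
theorem mellinConv_comm (f g : ℝ → ℝ) {x : ℝ} (hx : 0 < x) :
    mellinConv f g x = mellinConv g f x := by
  have h1 := integral_comp_rpow_Ioi (fun t => g t * f (x / t) / t) (p := -1) (by norm_num)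
  have h2 := integral_comp_mul_left_Ioi (fun s => g s⁻¹ * f (x * s) / s) 0 (inv_pos.2 hx)
  rw [mul_zero, inv_inv, smul_eq_mul] at h2
  have h3 : mellinConv g f x = ∫ s in Ioi 0, g s⁻¹ * f (x * s) / s := by
    rw [mellinConv, ← h1]
    refine setIntegral_congr_fun measurableSet_Ioi fun s hs => ?_
    have hs : 0 < s := hs
    have e : s ^ ((-1 : ℝ) - 1) = s⁻¹ * s⁻¹ := by
      rw [show (-1 : ℝ) - 1 = -1 + -1 by ring, Real.rpow_add hs, Real.rpow_neg_one]
    simp only [e, Real.rpow_neg_one, smul_eq_mul, abs_neg, abs_one, div_inv_eq_mul]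
    field_simp
  rw [h3, ← mul_right_inj' hx.ne', ← h2, mellinConv, ← integral_const_mul]
  refine setIntegral_congr_fun measurableSet_Ioi fun s hs => ?_
  have hs : 0 < s := hs
  simp only [mul_inv, inv_inv, mul_inv_cancel_left₀ hx.ne', ← div_eq_mul_inv]
  field_simp

theorem mellinConv_left_comm {k k' f : ℝ → ℝ} (hk : IsKernel k) (hk' : IsKernel k')
    (hf : f ∈ tame) : mellinConv k (mellinConv k' f) = mellinConv k' (mellinConv k f) := by
  ext x
  rcases le_or_gt x 0 with hx | hx
  · have hx' : x ∉ Ioo (0 : ℝ) 1 := fun h => not_lt.2 hx h.1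
    rw [tame.zero_off (mellinConv_mem_tame hk (mellinConv_mem_tame hk' hf)) hx',
      tame.zero_off (mellinConv_mem_tame hk' (mellinConv_mem_tame hk hf)) hx']
  have e1 : mellinConv k (mellinConv k' f) x =
      ∫ s in Ioi 0, ∫ t in Ioi 0, k s * k' t * f (x / (s * t)) / (s * t) := by
    unfold mellinConv
    refine integral_congr_ae (Eventually.of_forall fun s => ?_)
    simp only
    rw [← integral_const_mul, ← integral_div]
    refine integral_congr_ae (Eventually.of_forall fun t => ?_)
    simp only [div_div]
    rw [mul_comm s t]; ring
  have e2 : mellinConv k' (mellinConv k f) x =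
      ∫ t in Ioi 0, ∫ s in Ioi 0, k s * k' t * f (x / (s * t)) / (s * t) := by
    unfold mellinConv
    refine integral_congr_ae (Eventually.of_forall fun s => ?_)
    simp only
    rw [← integral_const_mul, ← integral_div]
    refine integral_congr_ae (Eventually.of_forall fun t => ?_)
    simp only [div_div]
    rw [mul_comm s t]; ring
  rw [e1, e2]
  refine integral_integral_swap ?_
  obtain ⟨C, hC, hCf⟩ := tame.bounded hf hx
  -- The integrand vanishes unless s and t lie in (x, 1) and st > x. There f is evaluated at a point
  -- ≥ x, and 1/(st) ≤ 1/x².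
  have hb := (((hk.integrable_indicator hx).restrict (s := Ioi 0)).mul_prod
    ((hk'.integrable_indicator hx).restrict (s := Ioi 0))).const_mul (C / (x * x))
  refine hb.mono' ?_ (Eventually.of_forall ?_)
  · refine Measurable.aestronglyMeasurable ?_
    have hfm := tame.measurable hf
    have hkm := hk.measurable
    have hkm' := hk'.measurable
    unfold Function.uncurry
    fun_prop
  · rintro ⟨s, t⟩
    simp only [Function.uncurry, Real.norm_eq_abs]
    have hR : 0 ≤ C / (x * x) *
        (indicator (Ioi x) (fun t => |k t|) s * indicator (Ioi x) (fun t => |k' t|) t) :=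
      mul_nonneg (by positivity) (mul_nonneg (indicator_nonneg (fun _ _ => abs_nonneg _) _)
        (indicator_nonneg (fun _ _ => abs_nonneg _) _))
    by_cases hs : s ∈ Ioo (0 : ℝ) 1
    swap
    · rw [hk.zero_off s hs]; simpa using hR
    by_cases ht : t ∈ Ioo (0 : ℝ) 1
    swap
    · rw [hk'.zero_off t ht]; simpa using hR
    have hst : 0 < s * t := mul_pos hs.1 ht.1
    by_cases h : x / (s * t) < 1
    swap
    · rw [hf.1 _ fun h' => h h'.2]; simpa using hR
    rw [div_lt_one hst] at h
    have hxs : x < s := h.trans (by nlinarith [hs.1, hs.2, ht.1, ht.2])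
    have hxt : x < t := h.trans (by nlinarith [hs.1, hs.2, ht.1, ht.2])
    rw [indicator_of_mem (show s ∈ Ioi x from hxs), indicator_of_mem (show t ∈ Ioi x from hxt),
      abs_div, abs_mul, abs_mul, abs_of_pos hst]
    have h1 : |f (x / (s * t))| ≤ C := hCf _ (by
      exact le_div_self hx.le hst (mul_le_one₀ hs.2.le ht.1.le ht.2.le))
    have hs0 := hs.1.le
    calc |k s| * |k' t| * |f (x / (s * t))| / (s * t) ≤ |k s| * |k' t| * C / (x * x) := by
          gcongr
      _ = _ := by ring

/-- Convolution with a kernel as a linear operator. -/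
def convOp (k : ℝ → ℝ) (hk : IsKernel k) : Module.End ℝ tame where
  toFun f := ⟨mellinConv k f, mellinConv_mem_tame hk f.2⟩
  map_add' f g := by
    ext x
    rcases le_or_gt x 0 with hx | hx
    · have hx' : x ∉ Ioo (0 : ℝ) 1 := fun h => not_lt.2 hx h.1
      change mellinConv k (f + g : tame) x = mellinConv k f x + mellinConv k g x
      rw [tame.zero_off (mellinConv_mem_tame hk (f + g).2) hx',
        tame.zero_off (mellinConv_mem_tame hk f.2) hx',
        tame.zero_off (mellinConv_mem_tame hk g.2) hx', add_zero]
    · change mellinConv k (f + g : tame) x = mellinConv k f x + mellinConv k g x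
      unfold mellinConv
      rw [← integral_add (integrable_mellinConv_integrand hk f.2 hx).restrict
        (integrable_mellinConv_integrand hk g.2 hx).restrict]
      refine integral_congr_ae (Eventually.of_forall fun t => ?_)
      simp; ring
  map_smul' c f := by
    ext x
    change mellinConv k (c • f : tame) x = c * mellinConv k f x
    unfold mellinConv
    rw [← integral_const_mul]
    refine integral_congr_ae (Eventually.of_forall fun t => ?_)
    simp; ring

theorem convOp_apply (k : ℝ → ℝ) (hk : IsKernel k) (f : tame) :
    (convOp k hk f : ℝ → ℝ) = mellinConv k f := rfl

theorem convOp_commute {k k' : ℝ → ℝ} (hk : IsKernel k) (hk' : IsKernel k') :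
    Commute (convOp k hk) (convOp k' hk') :=
  LinearMap.ext fun f => Subtype.ext (mellinConv_left_comm hk hk' f.2)

/-! ### Beta densities, powers and their convolution operators. -/

theorem betaDensity_zero_off (a b : ℝ) {x : ℝ} (hx : x ∉ Ioo (0 : ℝ) 1) : betaDensity a b x = 0 :=
  if_neg hx

theorem betaDensity_of_mem (a b : ℝ) {x : ℝ} (hx : x ∈ Ioo (0 : ℝ) 1) :
    betaDensity a b x = x ^ a * (1 - x) ^ (b - a - 1) / Real.Gamma (b - a) :=
  if_pos hx

theorem betaDensity_add_one_self {β x : ℝ} (hx : x ∈ Ioo (0 : ℝ) 1) :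
    betaDensity β (β + 1) x = x ^ β := by
  rw [betaDensity_of_mem _ _ hx]
  simp

theorem measurable_betaDensity (a b : ℝ) : Measurable (betaDensity a b) := by
  unfold betaDensity
  exact Measurable.ite measurableSet_Ioo (by fun_prop) measurable_const

theorem betaDensity_pos {a b : ℝ} (hab : a < b) {x : ℝ} (hx : x ∈ Ioo (0 : ℝ) 1) :
    0 < betaDensity a b x := by
  rw [betaDensity_of_mem _ _ hx]
  have := Real.Gamma_pos_of_pos (sub_pos.2 hab)
  have h1 := hx.1
  have h2 := sub_pos.2 hx.2
  positivity

theorem betaDensity_nonneg {a b : ℝ} (hab : a < b) (x : ℝ) : 0 ≤ betaDensity a b x := by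
  by_cases hx : x ∈ Ioo (0 : ℝ) 1
  · exact (betaDensity_pos hab hx).le
  · exact (betaDensity_zero_off a b hx).ge

theorem integrable_betaDensity {a b : ℝ} (ha : -1 < a) (hab : a < b) :
    Integrable (betaDensity a b) := by
  have hα : 0 < a + 1 := by linarith
  have hβ : 0 < b - a := sub_pos.2 hab
  have h1 : Integrable (ProbabilityTheory.betaPDFReal (a + 1) (b - a)) := by
    refine ⟨(ProbabilityTheory.measurable_betaPDFReal _ _).aestronglyMeasurable, ?_⟩
    rw [hasFiniteIntegral_iff_ofReal]
    · have := ProbabilityTheory.lintegral_betaPDF_eq_one hα hβ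
      unfold ProbabilityTheory.betaPDF at this
      rw [this]; simp
    · refine Eventually.of_forall fun x => ?_
      by_cases hx : 0 < x ∧ x < 1
      · exact (ProbabilityTheory.betaPDFReal_pos hx.1 hx.2 hα hβ).le
      · simp [ProbabilityTheory.betaPDFReal, hx]
  refine (h1.const_mul (ProbabilityTheory.beta (a + 1) (b - a) / Real.Gamma (b - a))).congr
    (Eventually.of_forall fun x => ?_)
  have := (ProbabilityTheory.beta_pos hα hβ).ne'
  by_cases hx : 0 < x ∧ x < 1
  · simp only [ProbabilityTheory.betaPDFReal, hx, and_self, if_true, betaDensity]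
    rw [add_sub_cancel_right]
    field_simp
  · simp [ProbabilityTheory.betaPDFReal, betaDensity, hx]

theorem rpow_le_max_of_mem {δ x : ℝ} (a : ℝ) (hδ : 0 < δ) (hx : δ ≤ x) (hx1 : x ≤ 1) :
    x ^ a ≤ max 1 (δ ^ a) := by
  rcases le_total 0 a with h | h
  · exact (Real.rpow_le_one (hδ.le.trans hx) hx1 h).trans (le_max_left _ _)
  · exact (Real.rpow_le_rpow_of_nonpos hδ hx h).trans (le_max_right _ _)

/-- Away from the origin x^a is bounded, so only the singularity at 1 matters and the case a = 0 is
enough for every real a. -/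
theorem isKernel_betaDensity {a b : ℝ} (hab : a < b) : IsKernel (betaDensity a b) := by
  refine ⟨fun x hx => betaDensity_zero_off a b hx, measurable_betaDensity a b, fun δ hδ => ?_⟩
  have h := (integrable_betaDensity (a := 0) (b := b - a) (by norm_num) (sub_pos.2 hab)).const_mul
    (max 1 (δ ^ a))
  refine (h.restrict (s := Ioi δ)).mono' (measurable_betaDensity a b).aestronglyMeasurable ?_
  refine (ae_restrict_iff' measurableSet_Ioi).2 (Eventually.of_forall fun x hx => ?_)
  rw [Real.norm_eq_abs, abs_of_nonneg (betaDensity_nonneg hab x)]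
  by_cases hx1 : x ∈ Ioo (0 : ℝ) 1
  · have e : betaDensity a b x = x ^ a * betaDensity 0 (b - a) x := by
      rw [betaDensity_of_mem _ _ hx1, betaDensity_of_mem _ _ hx1]
      simp [mul_div_assoc]
    rw [e]
    exact mul_le_mul_of_nonneg_right (rpow_le_max_of_mem a hδ (le_of_lt hx) hx1.2.le)
      (betaDensity_nonneg (sub_pos.2 hab) x)
  · rw [betaDensity_zero_off a b hx1, betaDensity_zero_off _ _ hx1, mul_zero]

/-- The function `x ^ β` on `(0, 1)`, extended by zero. -/
def powFn (β : ℝ) : tame :=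
  ⟨betaDensity β (β + 1), by
    refine ⟨fun x hx => betaDensity_zero_off _ _ hx, ?_, fun δ hδ =>
      ⟨max 1 (δ ^ β), by positivity, fun x hx => ?_⟩⟩
    · have : ContinuousOn (fun x : ℝ => x ^ β) (Ioo 0 1) :=
        fun x hx => (Real.continuousAt_rpow_const x β (Or.inl hx.1.ne')).continuousWithinAt
      exact this.congr fun x hx => betaDensity_add_one_self hx
    · by_cases hx1 : x ∈ Ioo (0 : ℝ) 1
      · rw [betaDensity_add_one_self hx1, abs_of_nonneg (Real.rpow_nonneg hx1.1.le _)]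
        exact rpow_le_max_of_mem β hδ hx hx1.2.le
      · rw [betaDensity_zero_off _ _ hx1]; simp⟩

theorem powFn_apply {β x : ℝ} (hx : x ∈ Ioo (0 : ℝ) 1) : (powFn β : ℝ → ℝ) x = x ^ β :=
  betaDensity_add_one_self hx

theorem tame_ext {f g : tame} (h : ∀ x ∈ Ioo (0 : ℝ) 1, (f : ℝ → ℝ) x = (g : ℝ → ℝ) x) : f = g := by
  ext x
  by_cases hx : x ∈ Ioo (0 : ℝ) 1
  · exact h x hx
  · rw [tame.zero_off f.2 hx, tame.zero_off g.2 hx]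

/-- Convolution with a power is a weighted primitive. -/
theorem mellinConv_powFn {k : ℝ → ℝ} (hk : ∀ x, x ∉ Ioo (0 : ℝ) 1 → k x = 0) (β : ℝ) {x : ℝ}
    (hx : x ∈ Ioo (0 : ℝ) 1) :
    mellinConv k (powFn β) x = x ^ β * ∫ t in x..1, t ^ (-β - 1) * k t := by
  rw [intervalIntegral.integral_of_le hx.2.le, integral_Ioc_eq_integral_Ioo, ← integral_const_mul,
    mellinConv]
  rw [setIntegral_eq_of_subset_of_forall_sdiff_eq_zero measurableSet_Ioi
    (show Ioo x 1 ⊆ Ioi 0 from fun t ht => hx.1.trans ht.1)]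
  · refine setIntegral_congr_fun measurableSet_Ioo fun t ht => ?_
    have ht0 : 0 < t := hx.1.trans ht.1
    have h : x / t ∈ Ioo (0 : ℝ) 1 := ⟨div_pos hx.1 ht0, by rw [div_lt_one ht0]; exact ht.1⟩
    rw [powFn_apply h, Real.div_rpow hx.1.le ht0.le, Real.rpow_sub ht0, Real.rpow_neg ht0.le,
      Real.rpow_one]
    field_simp
  · rintro t ⟨ht0, ht⟩
    have ht0 : 0 < t := ht0
    by_cases h1 : t < 1
    · rw [tame.zero_off (powFn β).2, mul_zero, zero_div]
      rintro ⟨-, h⟩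
      rw [div_lt_one ht0] at h
      exact ht ⟨h, h1⟩
    · rw [hk t fun h => h1 h.2]; simp

/-- With these parameters the powers of t cancel, and the elementary integral of (1-t)^(b-a-1)
remains. -/
theorem mellinConv_betaDensity_powFn {a b : ℝ} (hab : a < b) :
    mellinConv (betaDensity (a + 1) (b + 1)) (powFn a) = betaDensity a (b + 1) := by
  ext x
  by_cases hx : x ∈ Ioo (0 : ℝ) 1
  swap
  · rw [tame.zero_off (mellinConv_mem_tame (isKernel_betaDensity (by linarith)) (powFn a).2) hx,
      betaDensity_zero_off _ _ hx]
  have hc : 0 < b - a := sub_pos.2 hab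
  rw [mellinConv_powFn (fun x hx => betaDensity_zero_off _ _ hx) a hx, betaDensity_of_mem _ _ hx]
  have e : ∫ t in x..1, t ^ (-a - 1) * betaDensity (a + 1) (b + 1) t =
      ∫ t in x..1, (1 - t) ^ (b - a - 1) / Real.Gamma (b - a) := by
    rw [intervalIntegral.integral_of_le hx.2.le, integral_Ioc_eq_integral_Ioo,
      intervalIntegral.integral_of_le hx.2.le, integral_Ioc_eq_integral_Ioo]
    refine setIntegral_congr_fun measurableSet_Ioo fun t ht => ?_
    have ht0 : 0 < t := hx.1.trans ht.1
    rw [betaDensity_of_mem _ _ ⟨ht0, ht.2⟩, mul_div_assoc, ← mul_assoc, ← Real.rpow_add ht0]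
    simp
  rw [e, intervalIntegral.integral_div,
    intervalIntegral.integral_comp_sub_left (fun t => t ^ (b - a - 1)), sub_self,
    integral_rpow (Or.inl (by linarith)), sub_add_cancel, Real.zero_rpow hc.ne', sub_zero,
    show b + 1 - a = b - a + 1 by ring, Real.Gamma_add_one hc.ne',
    add_sub_cancel_right, mul_div_assoc, div_div]

/-- Convolution with the beta density with parameters `a < b`; the identity otherwise. -/
def betaOp (a b : ℝ) : Module.End ℝ tame :=
  if h : a < b then convOp (betaDensity a b) (isKernel_betaDensity h) else 1

theorem betaOp_apply {a b : ℝ} (h : a < b) (f : tame) :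
    (betaOp a b f : ℝ → ℝ) = mellinConv (betaDensity a b) f := by
  rw [betaOp, dif_pos h]; rfl

theorem betaOp_self (a : ℝ) : betaOp a a = 1 := dif_neg (lt_irrefl a)

theorem betaOp_commute (a b a' b' : ℝ) : Commute (betaOp a b) (betaOp a' b') := by
  unfold betaOp
  split_ifs
  · exact convOp_commute _ _
  · exact Commute.one_right _
  · exact Commute.one_left _
  · exact Commute.one_left _

/-- This is s + b = (s + a) + (b - a) on the Mellin side. For the kernels it is the splitting 1 = t
+ (1 - t). -/
theorem betaOp_eq_add {a b : ℝ} (hab : a ≤ b) :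
    betaOp a b = betaOp (a + 1) (b + 1) + (b - a) • betaOp a (b + 1) := by
  rcases hab.eq_or_lt with rfl | hab
  · simp [betaOp_self]
  refine LinearMap.ext fun f => tame_ext fun x hx => ?_
  have h1 : a < b + 1 := by linarith
  have h2 : a + 1 < b + 1 := by linarith
  simp only [LinearMap.add_apply, LinearMap.smul_apply, Submodule.coe_add, Submodule.coe_smul,
    Pi.add_apply, Pi.smul_apply, smul_eq_mul, betaOp_apply hab, betaOp_apply h1, betaOp_apply h2]
  unfold mellinConv
  rw [← integral_const_mul, ← integral_add
    (integrable_mellinConv_integrand (isKernel_betaDensity h2) f.2 hx.1).restrict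
    ((integrable_mellinConv_integrand (isKernel_betaDensity h1) f.2 hx.1).const_mul _).restrict]
  refine integral_congr_ae (Eventually.of_forall fun t => ?_)
  by_cases ht : t ∈ Ioo (0 : ℝ) 1
  · have hc : 0 < b - a := sub_pos.2 hab
    have ht1 : 0 < 1 - t := sub_pos.2 ht.2
    have hG := (Real.Gamma_pos_of_pos hc).ne'
    simp only [betaDensity_of_mem _ _ ht]
    rw [show b + 1 - (a + 1) = b - a by ring, show b + 1 - a = b - a + 1 by ring,
      Real.Gamma_add_one hc.ne', add_sub_cancel_right, Real.rpow_add ht.1,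
      Real.rpow_sub ht1 _ 1, Real.rpow_one, Real.rpow_one]
    field_simp
    ring
  · simp [betaDensity_zero_off _ _ ht]

theorem betaOp_powFn_shift {a b : ℝ} (hab : a ≤ b) :
    (betaOp (a + 1) (b + 1) (powFn a) : ℝ → ℝ) = betaDensity a (b + 1) := by
  rcases hab.eq_or_lt with rfl | hab
  · rw [betaOp_self]; rfl
  · rw [betaOp_apply (by linarith), mellinConv_betaDensity_powFn hab]

/-- Convolution with the power `x ^ β`. -/
abbrev powOp (β : ℝ) : Module.End ℝ tame := betaOp β (β + 1)

theorem powOp_apply_fun (β : ℝ) (f : tame) :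
    (powOp β f : ℝ → ℝ) = mellinConv (powFn β) f := betaOp_apply (lt_add_one β) f

theorem powOp_apply (β : ℝ) (f : tame) {x : ℝ} (hx : x ∈ Ioo (0 : ℝ) 1) :
    (powOp β f : ℝ → ℝ) x = x ^ β * ∫ t in x..1, t ^ (-β - 1) * (f : ℝ → ℝ) t := by
  rw [powOp_apply_fun, mellinConv_comm _ _ hx.1, mellinConv_powFn (fun x hx => f.2.1 x hx) β hx]

theorem powOp_powFn_comm (α β : ℝ) : powOp α (powFn β) = powOp β (powFn α) :=
  tame_ext fun x hx => by
    rw [powOp_apply_fun, powOp_apply_fun, mellinConv_comm _ _ hx.1]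

/-- Partial fractions for 1/((s+α)(s+β)), with the denominator β - α cleared so that no case
distinction is needed later. -/
theorem smul_powOp_powFn (α β : ℝ) : (β - α) • powOp α (powFn β) = powFn α - powFn β := by
  rcases eq_or_ne α β with rfl | h
  · simp
  have hne : β - α ≠ 0 := sub_ne_zero.2 h.symm
  refine tame_ext fun x hx => ?_
  simp only [Submodule.coe_smul, Submodule.coe_sub, Pi.smul_apply, Pi.sub_apply, smul_eq_mul,
    powOp_apply α _ hx, powFn_apply hx]
  have e : ∫ t in x..1, t ^ (-α - 1) * (powFn β : ℝ → ℝ) t = ∫ t in x..1, t ^ (β - α - 1) := by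
    rw [intervalIntegral.integral_of_le hx.2.le, integral_Ioc_eq_integral_Ioo,
      intervalIntegral.integral_of_le hx.2.le, integral_Ioc_eq_integral_Ioo]
    refine setIntegral_congr_fun measurableSet_Ioo fun t ht => ?_
    have ht0 : 0 < t := hx.1.trans ht.1
    rw [powFn_apply ⟨ht0, ht.2⟩, ← Real.rpow_add ht0]
    ring_nf
  rw [e, integral_rpow (Or.inr ⟨fun h' => hne (by linarith), ?_⟩), sub_add_cancel, Real.one_rpow,
    Real.rpow_sub hx.1]
  · have := (Real.rpow_pos_of_pos hx.1 α).ne'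
    field_simp
  · rw [uIcc_of_le hx.2.le]
    exact fun h' => not_lt.2 h'.1 hx.1

/-- If `k ∗ g = h` then convolving with `g` and then with `k` is convolving with `h`. -/
theorem mellinConv_assoc {k h f g : ℝ → ℝ} (hk : IsKernel k) (hf : f ∈ tame) (hg : g ∈ tame)
    (hkg : mellinConv k g = h) {x : ℝ} (hx : 0 < x) :
    mellinConv k (mellinConv g f) x = mellinConv h f x := by
  have e : ∀ t, mellinConv g f t = mellinConv f g t := by
    intro t
    rcases le_or_gt t 0 with ht | ht
    · have ht' : t ∉ Ioo (0 : ℝ) 1 := fun h => not_lt.2 ht h.1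
      rw [mellinConv_zero_off hf.1 hg.1 ht', mellinConv_zero_off hg.1 hf.1 ht']
    · exact mellinConv_comm _ _ ht
  rw [funext e, mellinConv_left_comm hk (tame.isKernel hf) hg, hkg, mellinConv_comm _ _ hx]

theorem betaOp_add_one {a b : ℝ} (hab : a ≤ b) :
    betaOp a (b + 1) = powOp a * betaOp (a + 1) (b + 1) := by
  rw [(betaOp_commute a (a + 1) (a + 1) (b + 1)).eq]
  rcases hab.eq_or_lt with rfl | hab
  · rw [betaOp_self, one_mul]
  refine LinearMap.ext fun f => tame_ext fun x hx => ?_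
  have h1 : a < b + 1 := by linarith
  have h2 : a + 1 < b + 1 := by linarith
  rw [betaOp_apply h1, Module.End.mul_apply, betaOp_apply h2, powOp_apply_fun]
  exact (mellinConv_assoc (isKernel_betaDensity h2) f.2 (powFn a).2
    (mellinConv_betaDensity_powFn hab) hx.1).symm

theorem powOp_sub_powOp (a b : ℝ) : powOp a - powOp b = (b - a) • (powOp a * powOp b) := by
  refine LinearMap.ext fun f => tame_ext fun x hx => ?_
  have h : mellinConv (powFn a) (powFn b) = (powOp a (powFn b) : ℝ → ℝ) :=
    (powOp_apply_fun a _).symm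
  have h2 := mellinConv_assoc (tame.isKernel (powFn a).2) f.2 (powFn b).2 h hx.1
  have h3 : (b - a) * mellinConv (powOp a (powFn b) : ℝ → ℝ) f x =
      mellinConv (powFn a) f x - mellinConv (powFn b) f x := by
    -- Convolving with f carries the partial fraction identity from functions to operators.
    have h4 := congrArg (fun g => (convOp f (tame.isKernel f.2) g : ℝ → ℝ) x)
      (smul_powOp_powFn a b)
    simp only [map_smul, map_sub, Submodule.coe_smul, Submodule.coe_sub, Pi.smul_apply,
      Pi.sub_apply, smul_eq_mul, convOp_apply] at h4
    rwa [mellinConv_comm _ _ hx.1, mellinConv_comm (powFn a) _ hx.1,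
      mellinConv_comm (powFn b) _ hx.1]
  simp only [LinearMap.sub_apply, LinearMap.smul_apply, Submodule.coe_smul, Submodule.coe_sub,
    Pi.smul_apply, Pi.sub_apply, smul_eq_mul, Module.End.mul_apply, powOp_apply_fun]
  rw [← h3, ← h2]

/-- Multiplication by the variable. -/
def mulX : Module.End ℝ tame where
  toFun f := ⟨fun x => x * (f : ℝ → ℝ) x, by
    refine ⟨fun x hx => mul_eq_zero_of_right x (tame.zero_off f.2 hx),
      continuousOn_id.mul (tame.continuousOn f.2), fun δ hδ => ?_⟩
    obtain ⟨C, hC, hCf⟩ := tame.bounded f.2 hδ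
    refine ⟨C, hC, fun x hx => ?_⟩
    by_cases hx1 : x ∈ Ioo (0 : ℝ) 1
    · rw [abs_mul, abs_of_pos hx1.1]
      exact (mul_le_of_le_one_left (abs_nonneg _) hx1.2.le).trans (hCf x hx)
    · simpa [tame.zero_off f.2 hx1] using hC⟩
  map_add' f g := by ext x; simp [mul_add]
  map_smul' c f := by ext x; simp [mul_left_comm]

theorem mulX_apply (f : tame) (x : ℝ) : (mulX f : ℝ → ℝ) x = x * (f : ℝ → ℝ) x := rfl

theorem mulX_powFn (β : ℝ) : mulX (powFn β) = powFn (β + 1) :=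
  tame_ext fun x hx => by
    rw [mulX_apply, powFn_apply hx, powFn_apply hx, Real.rpow_add_one hx.1.ne', mul_comm]

theorem mulX_mul_betaOp (a b : ℝ) : mulX * betaOp a b = betaOp (a + 1) (b + 1) * mulX := by
  by_cases hab : a < b
  · refine LinearMap.ext fun f => tame_ext fun x hx => ?_
    have h2 : a + 1 < b + 1 := by linarith
    rw [Module.End.mul_apply, Module.End.mul_apply, mulX_apply, betaOp_apply hab, betaOp_apply h2]
    unfold mellinConv
    rw [← integral_const_mul]
    refine integral_congr_ae (Eventually.of_forall fun t => ?_)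
    simp only [mulX_apply]
    by_cases ht : t ∈ Ioo (0 : ℝ) 1
    · have := ht.1.ne'
      rw [betaDensity_of_mem _ _ ht, betaDensity_of_mem _ _ ht, Real.rpow_add_one ht.1.ne',
        show b + 1 - (a + 1) = b - a by ring]
      field_simp
    · simp [betaDensity_zero_off _ _ ht]
  · rw [betaOp, dif_neg hab, betaOp, dif_neg (by linarith), mul_one, one_mul]

/-! ### The functional equation of Γ as identities in a commutative algebra. -/

/-- The commutative algebra generated by the beta operators. -/
def betaAlg : Subalgebra ℝ (Module.End ℝ tame) :=
  Algebra.adjoin ℝ (range fun p : ℝ × ℝ => betaOp p.1 p.2)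

instance : IsMulCommutative betaAlg :=
  Algebra.isMulCommutative_adjoin ℝ (by
    rintro _ ⟨p, rfl⟩ _ ⟨q, rfl⟩
    exact (betaOp_commute _ _ _ _).eq)

/-- With commutativity, operator identities are within reach of `linear_combination` and `Finset`
products. -/
instance : CommRing betaAlg :=
  { @Subalgebra.toRing ℝ (Module.End ℝ tame) _ _ _ betaAlg with
    mul_comm := fun a b => IsMulCommutative.is_comm.comm a b }

theorem betaAlg_add_apply (x y : betaAlg) (f : tame) : (x + y).1 f = x.1 f + y.1 f := rfl

theorem betaAlg_sub_apply (x y : betaAlg) (f : tame) : (x - y).1 f = x.1 f - y.1 f := rfl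

theorem betaAlg_mul_apply (x y : betaAlg) (f : tame) : (x * y).1 f = x.1 (y.1 f) := rfl

theorem betaAlg_smul_apply (c : ℝ) (x : betaAlg) (f : tame) : (c • x).1 f = c • x.1 f := rfl

theorem betaAlg_one_apply (f : tame) : (1 : betaAlg).1 f = f := rfl

/-- The beta operator as an element of the commutative algebra `betaAlg`. -/
def betaEl (a b : ℝ) : betaAlg := ⟨betaOp a b, Algebra.subset_adjoin ⟨(a, b), rfl⟩⟩

/-- Convolution with a power as an element of `betaAlg`. -/
abbrev powEl (β : ℝ) : betaAlg := betaEl β (β + 1)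

theorem coe_betaEl (a b : ℝ) : (betaEl a b).1 = betaOp a b := rfl

theorem betaEl_self (a : ℝ) : betaEl a a = 1 := Subtype.ext (betaOp_self a)

theorem powEl_sub_powEl (a b : ℝ) : powEl a - powEl b = (b - a) • (powEl a * powEl b) :=
  Subtype.ext (powOp_sub_powOp a b)

theorem betaEl_add_one_left {a b : ℝ} (hab : a ≤ b) :
    betaEl a (b + 1) = powEl a * betaEl (a + 1) (b + 1) :=
  Subtype.ext (betaOp_add_one hab)

theorem betaEl_eq_add {a b : ℝ} (hab : a ≤ b) :
    betaEl a b = betaEl (a + 1) (b + 1) + (b - a) • betaEl a (b + 1) :=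
  Subtype.ext (betaOp_eq_add hab)

theorem betaEl_add_one {a b : ℝ} (hab : a ≤ b) : betaEl a (b + 1) = betaEl a b * powEl b := by
  have h := powEl_sub_powEl a b
  rw [betaEl_eq_add hab, betaEl_add_one_left hab]
  rw [Algebra.smul_def] at h ⊢
  linear_combination (betaEl (a + 1) (b + 1)) * h

/-- The last factor has Mellin symbol (s+a)/(s+b), the ratio between the symbols at s + 1 and at s.
-/
theorem betaEl_shift {a b : ℝ} (hab : a ≤ b) :
    betaEl (a + 1) (b + 1) = betaEl a b * (1 - (b - a) • powEl b) := by
  have h := betaEl_eq_add hab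
  rw [betaEl_add_one hab] at h
  rw [Algebra.smul_def] at h ⊢
  linear_combination -h

/-- The convolution with x^b is not an elementary integral, but the one with x^a after the shift
(`betaOp_powFn_shift`) is. The algebra relates the two. -/
theorem betaOp_powFn {a b : ℝ} (hab : a ≤ b) :
    (betaOp a b (powFn b) : ℝ → ℝ) = betaDensity a (b + 1) := by
  rw [← betaOp_powFn_shift hab]
  congr 1
  have h1 := congrArg (fun x : betaAlg => x.1 (powFn b)) (betaEl_eq_add hab)
  rw [betaEl_add_one_left hab, mul_comm (powEl a)] at h1
  simp only [betaAlg_add_apply, betaAlg_smul_apply, betaAlg_mul_apply, coe_betaEl] at h1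
  rw [h1, ← map_smul, smul_powOp_powFn, ← map_add]
  congr 1
  abel

/-! ### Reordering the convolution, and the weights as images of powers. -/

/-- A nonnegative integrable function supported in `(0, 1)`. -/
structure IsDensity (f : ℝ → ℝ) : Prop where
  zero_off : ∀ x, x ∉ Ioo (0 : ℝ) 1 → f x = 0
  nonneg : ∀ x, 0 ≤ f x
  measurable : Measurable f
  integrable : Integrable f

theorem isDensity_betaDensity {a b : ℝ} (ha : -1 < a) (hab : a < b) :
    IsDensity (betaDensity a b) :=
  ⟨fun _ hx => betaDensity_zero_off a b hx, betaDensity_nonneg hab, measurable_betaDensity a b,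
    integrable_betaDensity ha hab⟩

theorem mellinConv_nonneg {k f : ℝ → ℝ} (hk : ∀ x, 0 ≤ k x) (hf : ∀ x, 0 ≤ f x) (x : ℝ) :
    0 ≤ mellinConv k f x :=
  setIntegral_nonneg measurableSet_Ioi fun t (ht : 0 < t) =>
    div_nonneg (mul_nonneg (hk t) (hf _)) ht.le

theorem integrable_prod_mellinConv {k f : ℝ → ℝ} (hk : IsDensity k) (hf : IsDensity f) :
    Integrable (fun z : ℝ × ℝ => k z.2 * f (z.1 / z.2) / z.2)
      (volume.prod (volume.restrict (Ioi 0))) := by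
  have hm : Measurable fun z : ℝ × ℝ => k z.2 * f (z.1 / z.2) / z.2 := by
    have := hk.measurable
    have := hf.measurable
    fun_prop
  rw [integrable_prod_iff' hm.aestronglyMeasurable]
  constructor
  · refine (ae_restrict_iff' measurableSet_Ioi).2 (Eventually.of_forall fun t (ht : 0 < t) => ?_)
    exact ((hf.integrable.comp_div ht.ne').const_mul (k t)).div_const t
  · refine ((hk.integrable.mul_const (∫ x, f x)).restrict (s := Ioi 0)).congr ?_
    refine (ae_restrict_iff' measurableSet_Ioi).2 (Eventually.of_forall fun t (ht : 0 < t) => ?_)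
    have : ∀ x, ‖k t * f (x / t) / t‖ = k t * f (x / t) / t := fun x =>
      Real.norm_of_nonneg (div_nonneg (mul_nonneg (hk.nonneg t) (hf.nonneg _)) ht.le)
    simp only [this]
    rw [integral_div, integral_const_mul, Measure.integral_comp_div, abs_of_pos ht, smul_eq_mul]
    field_simp

theorem IsDensity.mellinConv {k f : ℝ → ℝ} (hk : IsDensity k) (hf : IsDensity f) :
    IsDensity (mellinConv k f) := by
  refine ⟨fun x hx => mellinConv_zero_off hk.zero_off hf.zero_off hx,
    mellinConv_nonneg hk.nonneg hf.nonneg, ?_, (integrable_prod_mellinConv hk hf).integral_prod_left⟩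
  have hm : StronglyMeasurable (Function.uncurry fun x t : ℝ => k t * f (x / t) / t) := by
    refine Measurable.stronglyMeasurable ?_
    have := hk.measurable
    have := hf.measurable
    unfold Function.uncurry
    fun_prop
  exact (StronglyMeasurable.integral_prod_right (ν := volume.restrict (Ioi 0)) hm).measurable

theorem mellinConv_eq_toReal {k f : ℝ → ℝ} (hk : IsDensity k) (hf : IsDensity f) (x : ℝ) :
    mellinConv k f x = (∫⁻ t in Ioi 0, ENNReal.ofReal (k t * f (x / t) / t)).toReal := by
  refine integral_eq_lintegral_of_nonneg_ae ?_
    (measurable_mellinConv_integrand hk.measurable hf.measurable x).aestronglyMeasurable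
  exact (ae_restrict_iff' measurableSet_Ioi).2 (Eventually.of_forall fun t (ht : 0 < t) =>
    div_nonneg (mul_nonneg (hk.nonneg t) (hf.nonneg _)) ht.le)

/-- The map y ↦ x/y is differentiable away from 0, hence sends null sets to null sets. -/
theorem ae_comp_const_div {p : ℝ → Prop} (hp : ∀ᵐ x, p x) (x : ℝ) (hx : x ≠ 0) :
    ∀ᵐ s ∂(volume.restrict (Ioi (0 : ℝ))), p (x / s) := by
  rw [ae_restrict_iff' measurableSet_Ioi]
  have h0 : volume ({y | ¬ p y} ∩ {0}ᶜ) = 0 := measure_mono_null inter_subset_left (ae_iff.1 hp)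
  have h1 := addHaar_image_eq_zero_of_differentiableOn_of_addHaar_eq_zero volume
    (f := fun y : ℝ => x / y) (s := {y | ¬ p y} ∩ {0}ᶜ) (fun y hy =>
      ((differentiableAt_const x).div differentiableAt_id hy.2).differentiableWithinAt) h0
  rw [ae_iff]
  refine measure_mono_null ?_ h1
  intro s hs
  simp only [mem_ofPred_eq, Classical.not_imp] at hs
  have hs0 : s ≠ 0 := ne_of_gt hs.1
  exact ⟨x / s, ⟨hs.2, div_ne_zero hx hs0⟩, by field_simp⟩

theorem ofReal_mellinConv_ae {k f : ℝ → ℝ} (hk : IsDensity k) (hf : IsDensity f) :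
    ∀ᵐ x, ENNReal.ofReal (mellinConv k f x) =
      ∫⁻ t in Ioi 0, ENNReal.ofReal (k t * f (x / t) / t) := by
  filter_upwards [(integrable_prod_mellinConv hk hf).prod_right_ae] with x hx
  rw [mellinConv_eq_toReal hk hf, ENNReal.ofReal_toReal]
  exact (hx.lintegral_lt_top).ne

/-- The inner Bochner integral agrees with its Lebesgue counterpart only almost everywhere, since
the latter may be infinite on a null set; for almost every s the point x/s avoids it. -/
theorem mellinConv_mellinConv_eq {k k' f : ℝ → ℝ} (hk : IsDensity k) (hk' : IsDensity k')
    (hf : IsDensity f) {x : ℝ} (hx : x ≠ 0) :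
    mellinConv k (mellinConv k' f) x = (∫⁻ s in Ioi 0, ∫⁻ t in Ioi 0,
      ENNReal.ofReal (k s * k' t * f (x / (s * t)) / (s * t))).toReal := by
  rw [mellinConv_eq_toReal hk (hk'.mellinConv hf)]
  congr 1
  refine lintegral_congr_ae ?_
  filter_upwards [ae_comp_const_div (ofReal_mellinConv_ae hk' hf) x hx,
    ae_restrict_mem measurableSet_Ioi] with s hs (hs0 : 0 < s)
  have h1 : 0 ≤ k s / s := div_nonneg (hk.nonneg s) hs0.le
  rw [show k s * mellinConv k' f (x / s) / s = k s / s * mellinConv k' f (x / s) by ring,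
    ENNReal.ofReal_mul h1, hs, ← lintegral_const_mul]
  · refine lintegral_congr fun t => ?_
    rw [← ENNReal.ofReal_mul h1, div_div]
    congr 1
    rw [div_mul_div_comm]
    ring
  · exact (measurable_mellinConv_integrand hk'.measurable hf.measurable _).ennreal_ofReal

/-- Beta densities of order below 1 are unbounded at 1 and so not `tame`. Nonnegativity and Tonelli
replace the dominating bound. -/
theorem mellinConv_left_comm_density {k k' f : ℝ → ℝ} (hk : IsDensity k) (hk' : IsDensity k')
    (hf : IsDensity f) : mellinConv k (mellinConv k' f) = mellinConv k' (mellinConv k f) := by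
  ext x
  by_cases hx : x ∈ Ioo (0 : ℝ) 1
  swap
  · rw [(hk.mellinConv (hk'.mellinConv hf)).zero_off x hx,
      (hk'.mellinConv (hk.mellinConv hf)).zero_off x hx]
  rw [mellinConv_mellinConv_eq hk hk' hf hx.1.ne', mellinConv_mellinConv_eq hk' hk hf hx.1.ne',
    lintegral_lintegral_swap]
  · congr 1
    refine lintegral_congr fun t => lintegral_congr fun s => ?_
    rw [mul_comm s t, mul_comm (k s)]
  · refine Measurable.aemeasurable ?_
    have := hk.measurable
    have := hk'.measurable
    have := hf.measurable
    unfold Function.uncurry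
    fun_prop

theorem isDensity_betaConv : ∀ (l : List (ℝ × ℝ)), (∀ p ∈ l, -1 < p.1 ∧ p.1 < p.2) →
    IsDensity (betaConv l)
  | [], _ => ⟨fun _ _ => rfl, fun _ => le_rfl, measurable_const, integrable_zero _ _ _⟩
  | [p], h => isDensity_betaDensity (h p (by simp)).1 (h p (by simp)).2
  | p :: q :: l, h => (isDensity_betaDensity (h p (by simp)).1 (h p (by simp)).2).mellinConv
      (isDensity_betaConv (q :: l) fun p' hp' => h p' (List.mem_cons_of_mem _ hp'))

theorem betaConv_cons {p : ℝ × ℝ} {l : List (ℝ × ℝ)} (hl : l ≠ []) :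
    betaConv (p :: l) = mellinConv (betaDensity p.1 p.2) (betaConv l) := by
  cases l with
  | nil => exact absurd rfl hl
  | cons q l => rfl

theorem betaConv_perm {l l' : List (ℝ × ℝ)} (hp : l.Perm l')
    (h : ∀ p ∈ l, -1 < p.1 ∧ p.1 < p.2) : betaConv l = betaConv l' := by
  induction hp with
  | nil => rfl
  | @cons p l l' hp ih =>
    cases l with
    | nil => rw [List.nil_perm.1 hp]
    | cons q l =>
      have h' : l' ≠ [] := fun e => by rw [e] at hp; simpa using hp.length_eq
      rw [betaConv_cons h', ← ih fun p hp => h p (List.mem_cons_of_mem _ hp)]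
      rfl
  | swap p q l =>
    have hp := h p (by simp)
    have hq := h q (by simp)
    have dp := isDensity_betaDensity hp.1 hp.2
    have dq := isDensity_betaDensity hq.1 hq.2
    cases l with
    | nil =>
      ext x
      by_cases hx : x ∈ Ioo (0 : ℝ) 1
      · exact mellinConv_comm _ _ hx.1
      · exact ((dq.mellinConv dp).zero_off x hx).trans ((dp.mellinConv dq).zero_off x hx).symm
    | cons s l =>
      exact mellinConv_left_comm_density dq dp
        (isDensity_betaConv _ fun p' hp' => h p' (by
          exact List.mem_cons_of_mem _ (List.mem_cons_of_mem _ hp')))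
  | trans hp hp' ih ih' =>
    rw [ih h, ih' fun p hp'' => h p (hp.mem_iff.2 hp'')]

theorem betaConv_append_singleton (l : List (ℝ × ℝ)) (hl : ∀ p ∈ l, p.1 < p.2) (q : ℝ × ℝ)
    (f : tame) (hf : (f : ℝ → ℝ) = betaDensity q.1 q.2) :
    betaConv (l ++ [q]) = ((l.map fun p => betaEl p.1 p.2).prod.1 f : ℝ → ℝ) := by
  induction l with
  | nil => exact hf.symm
  | cons p l ih =>
    rw [List.cons_append, betaConv_cons (by simp), ih fun p hp => hl p (List.mem_cons_of_mem _ hp),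
      List.map_cons, List.prod_cons, betaAlg_mul_apply, coe_betaEl, betaOp_apply (hl p (by simp))]

theorem prod_map_filter_betaEl (l : List (ℝ × ℝ)) :
    ((l.filter fun p => p.1 ≠ p.2).map fun p => betaEl p.1 p.2).prod =
      (l.map fun p => betaEl p.1 p.2).prod := by
  induction l with
  | nil => rfl
  | cons p l ih =>
    by_cases h : p.1 = p.2
    · rw [List.filter_cons_of_neg (by simpa using h), ih, List.map_cons, List.prod_cons, h,
        betaEl_self, one_mul]
    · rw [List.filter_cons_of_pos (by simpa using h), List.map_cons, List.prod_cons, ih,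
        List.map_cons, List.prod_cons]

/-- The weights are obtained from the powers `x ^ bⱼ` by one common operator. -/
theorem weight_eq {r : ℕ} (a b : Fin r → ℝ) (ha : ∀ j, -1 < a j) (hab : ∀ j, a j ≤ b j)
    (j : Fin r) : weight a b j = ((∏ i, betaEl (a i) (b i)).1 (powFn (b j)) : ℝ → ℝ) := by
  classical
  set g : Fin r → ℝ × ℝ := fun i => (a i, (b + Pi.single j 1 : Fin r → ℝ) i) with hg
  have hgj : g j = (a j, b j + 1) := by simp [hg]
  have hgi : ∀ i, i ≠ j → g i = (a i, b i) := fun i hi => by simp [hg, hi]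
  -- Index j is moved to the innermost place: its density with upper parameter b_j + 1 is the `tame`
  -- function `betaOp (a j) (b j) (powFn (b j))`, on which the other operators can act.
  have hperm : (List.finRange r).Perm ((List.finRange r).erase j ++ [j]) :=
    (List.perm_cons_erase (List.mem_finRange j)).trans (List.perm_append_singleton _ _).symm
  have hgle : ∀ i, (g i).1 ≤ (g i).2 := fun i => by
    by_cases hi : i = j
    · rw [hi, hgj]; have := hab j; simp only; linarith
    · rw [hgi i hi]; exact hab i
  have hmem : ∀ l : List (Fin r), ∀ p ∈ (l.map g).filter (fun p => p.1 ≠ p.2),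
      -1 < p.1 ∧ p.1 < p.2 := by
    intro l p hp
    rw [List.mem_filter, List.mem_map] at hp
    obtain ⟨⟨i, -, rfl⟩, hne⟩ := hp
    exact ⟨ha i, lt_of_le_of_ne (hgle i) (by simpa using hne)⟩
  have e1 : weight a b j = betaConv (((List.finRange r).map g).filter fun p => p.1 ≠ p.2) := by
    rw [weight, baseWeight, List.ofFn_eq_map]
  rw [e1, betaConv_perm ((hperm.map g).filter _) (hmem _), List.map_append, List.filter_append,
    List.map_singleton, hgj, List.filter_cons_of_pos (by
      have := hab j
      simp only [ne_eq, decide_eq_true_eq]; intro h; linarith), List.filter_nil,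
    betaConv_append_singleton _ (fun p hp => (hmem _ p hp).2) _ _ (betaOp_powFn (hab j)),
    prod_map_filter_betaEl, List.map_map]
  have e2 : ((List.finRange r).erase j).map ((fun p : ℝ × ℝ => betaEl p.1 p.2) ∘ g) =
      ((List.finRange r).erase j).map fun i => betaEl (a i) (b i) := by
    refine List.map_congr_left fun i hi => ?_
    have hij : i ≠ j := ((List.nodup_finRange r).mem_erase_iff.1 hi).1
    rw [Function.comp_apply, hgi i hij]
  have e3 : ∏ i, betaEl (a i) (b i) =
      (((List.finRange r).erase j).map fun i => betaEl (a i) (b i)).prod * betaEl (a j) (b j) := by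
    rw [← List.prod_ofFn, List.ofFn_eq_map, (hperm.map _).prod_eq, List.map_append,
      List.prod_append, List.map_singleton, List.prod_singleton]
  rw [e2, e3, betaAlg_mul_apply, coe_betaEl]

/-! ### Counting zeros under beta operators. -/

/-- The zeros of a function in `(0, 1)`. -/
def zeros (f : ℝ → ℝ) : Set ℝ := {x ∈ Ioo (0 : ℝ) 1 | f x = 0}

theorem mem_zeros {f : ℝ → ℝ} {x : ℝ} : x ∈ zeros f ↔ x ∈ Ioo (0 : ℝ) 1 ∧ f x = 0 := Iff.rfl

theorem encard_le_of_interleaved {A B : Set ℝ}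
    (h : ∀ x ∈ A, ∀ y ∈ A, x < y → ∃ z ∈ B, x < z ∧ z < y) : A.encard ≤ B.encard + 1 := by
  by_contra! hlt
  have hB : B.Finite := by
    rw [← encard_lt_top_iff]
    exact (le_self_add.trans_lt hlt).trans_le le_top
  obtain ⟨s, hsA, hs⟩ := exists_subset_encard_eq (Order.add_one_le_of_lt hlt)
  have hsf : s.Finite := by
    rw [← encard_lt_top_iff, hs, hB.encard_eq_coe_toFinset_card]
    exact_mod_cast ENat.natCast_lt_top _
  have h1 := Finset.card_le_of_interleaved (s := hsf.toFinset) (t := hB.toFinset)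
    fun x hx y hy hxy _ => by
      obtain ⟨z, hz, hz'⟩ := h x (hsA (hsf.mem_toFinset.1 hx)) y (hsA (hsf.mem_toFinset.1 hy)) hxy
      exact ⟨z, hB.mem_toFinset.2 hz, hz'⟩
  rw [hsf.encard_eq_coe_toFinset_card, hB.encard_eq_coe_toFinset_card] at hs
  norm_cast at hs
  omega

theorem pos_or_neg_of_ne_zero {f : ℝ → ℝ} {x y : ℝ} (hf : ContinuousOn f (Ioo x y))
    (h0 : ∀ z ∈ Ioo x y, f z ≠ 0) : (∀ z ∈ Ioo x y, 0 < f z) ∨ ∀ z ∈ Ioo x y, f z < 0 := by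
  by_contra! h
  obtain ⟨⟨u, hu, hfu⟩, v, hv, hfv⟩ := h
  obtain ⟨w, hw, hfw⟩ := isPreconnected_Ioo.intermediate_value hu hv hf ⟨hfu, hfv⟩
  exact h0 w hw hfw

theorem intervalIntegrable_rpow_mul (β : ℝ) (f : tame) {x y : ℝ} (hx : 0 < x) (hy : 0 < y) :
    IntervalIntegrable (fun t => t ^ (-β - 1) * (f : ℝ → ℝ) t) volume x y := by
  have hm : 0 < min x y / 2 := half_pos (lt_min hx hy)
  refine IntervalIntegrable.continuousOn_mul (f := (f : ℝ → ℝ)) ?_ fun t ht => ?_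
  · rw [intervalIntegrable_iff]
    refine ((tame.isKernel f.2).integrableOn _ hm).mono_set fun t ht => ?_
    exact (half_lt_self (lt_min hx hy)).trans ht.1
  · exact (Real.continuousAt_rpow_const t _
      (Or.inl ((lt_min hx hy).trans_le ht.1).ne')).continuousWithinAt

theorem exists_zero_of_integral_eq_zero (β : ℝ) (f : tame) {x y : ℝ} (hx : 0 < x) (hxy : x < y)
    (hy : y ≤ 1) (h : ∫ t in x..y, t ^ (-β - 1) * (f : ℝ → ℝ) t = 0) :
    ∃ z ∈ zeros f, x < z ∧ z < y := by
  by_contra! hne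
  have hsub : Ioo x y ⊆ Ioo 0 1 := fun z hz => ⟨hx.trans hz.1, hz.2.trans_le hy⟩
  have h0 : ∀ z ∈ Ioo x y, (f : ℝ → ℝ) z ≠ 0 := fun z hz hfz =>
    not_lt.2 (hne z ⟨hsub hz, hfz⟩ hz.1) hz.2
  have hint := intervalIntegrable_rpow_mul β f hx (hx.trans hxy)
  rcases pos_or_neg_of_ne_zero ((tame.continuousOn f.2).mono hsub) h0 with hp | hn
  · exact (intervalIntegral.intervalIntegral_pos_of_pos_on hint (fun z hz =>
      mul_pos (Real.rpow_pos_of_pos (hsub hz).1 _) (hp z hz)) hxy).ne' h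
  · refine (intervalIntegral.intervalIntegral_pos_of_pos_on hint.neg (fun z hz =>
      neg_pos.2 (mul_neg_of_pos_of_neg (Real.rpow_pos_of_pos (hsub hz).1 _) (hn z hz))) hxy).ne' ?_
    simpa using h

/-- After division by x^β the function is c plus a primitive, so between two zeros the integral of
t^(-β-1) f vanishes and f has a zero (Rolle). -/
theorem encard_zeros_smul_powFn_add_le (c β : ℝ) (f : tame) :
    (zeros (c • powFn β + powOp β f : tame)).encard ≤ (zeros f).encard + 1 := by
  have key : ∀ x ∈ zeros (c • powFn β + powOp β f : tame),
      c + ∫ t in x..1, t ^ (-β - 1) * (f : ℝ → ℝ) t = 0 := by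
    rintro x ⟨hx, h⟩
    rw [Submodule.coe_add, Submodule.coe_smul, Pi.add_apply, Pi.smul_apply, smul_eq_mul,
      powFn_apply hx, powOp_apply _ _ hx] at h
    have h0 := (Real.rpow_pos_of_pos hx.1 β).ne'
    refine (mul_eq_zero.1 (?_ : x ^ β * _ = 0)).resolve_left h0
    rw [← h]; ring
  refine encard_le_of_interleaved fun x hx y hy hxy => ?_
  refine exists_zero_of_integral_eq_zero β f hx.1.1 hxy hy.1.2.le ?_
  have h := intervalIntegral.integral_add_adjacent_intervals
    (intervalIntegrable_rpow_mul β f hx.1.1 hy.1.1) (intervalIntegrable_rpow_mul β f hy.1.1 one_pos)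
  linarith [key x hx, key y hy]

/-- With no constant term the primitive also vanishes at 1. This additional endpoint absorbs the
zero lost in Rolle's theorem. -/
theorem encard_zeros_powOp_le (β : ℝ) (f : tame) :
    (zeros (powOp β f)).encard ≤ (zeros f).encard := by
  have key : ∀ x ∈ insert 1 (zeros (powOp β f)),
      0 < x ∧ x ≤ 1 ∧ ∫ t in x..1, t ^ (-β - 1) * (f : ℝ → ℝ) t = 0 := by
    rintro x (rfl | ⟨hx, h⟩)
    · exact ⟨one_pos, le_rfl, intervalIntegral.integral_same⟩
    · rw [powOp_apply _ _ hx] at h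
      exact ⟨hx.1, hx.2.le, (mul_eq_zero.1 h).resolve_left (Real.rpow_pos_of_pos hx.1 β).ne'⟩
  have h1 : (insert 1 (zeros (powOp β f))).encard ≤ (zeros f).encard + 1 := by
    refine encard_le_of_interleaved fun x hx y hy hxy => ?_
    obtain ⟨hx0, -, hx1⟩ := key x hx
    obtain ⟨hy0, hy', hy1⟩ := key y hy
    refine exists_zero_of_integral_eq_zero β f hx0 hxy hy' ?_
    have h := intervalIntegral.integral_add_adjacent_intervals
      (intervalIntegrable_rpow_mul β f hx0 hy0) (intervalIntegrable_rpow_mul β f hy0 one_pos)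
    linarith
  rw [encard_insert_of_notMem fun h => lt_irrefl _ h.1.2] at h1
  exact (ENat.add_le_add_iff_right ENat.one_ne_top).1 h1

/-- Division by the variable. -/
def divX (f : tame) : tame :=
  ⟨fun x => (f : ℝ → ℝ) x / x, by
    refine ⟨fun x hx => by simp [tame.zero_off f.2 hx],
      (tame.continuousOn f.2).div continuousOn_id fun x hx => hx.1.ne', fun δ hδ => ?_⟩
    obtain ⟨C, hC, hCf⟩ := tame.bounded f.2 hδ
    refine ⟨C / δ, by positivity, fun x hx => ?_⟩
    rw [abs_div, abs_of_pos (hδ.trans_le hx)]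
    have := hCf x hx
    gcongr⟩

theorem divX_apply (f : tame) (x : ℝ) : (divX f : ℝ → ℝ) x = (f : ℝ → ℝ) x / x := rfl

theorem mulX_divX (f : tame) : mulX (divX f) = f :=
  tame_ext fun x hx => by
    rw [mulX_apply, divX_apply]
    have := hx.1.ne'
    field_simp

theorem betaOp_pos {a b : ℝ} (hab : a < b) {f : tame} (hfin : (zeros f).Finite) {x : ℝ}
    (hx : x ∈ Ioo (0 : ℝ) 1) (hf : ∀ y ∈ Ioo x 1, 0 ≤ (f : ℝ → ℝ) y) :
    0 < (betaOp a b f : ℝ → ℝ) x := by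
  rw [betaOp_apply hab, mellinConv]
  have hmem : ∀ t, x < t → t < 1 → x / t ∈ Ioo x 1 := fun t h1 h2 => by
    have ht : 0 < t := hx.1.trans h1
    exact ⟨by rw [lt_div_iff₀ ht]; nlinarith [hx.1], by rwa [div_lt_one ht]⟩
  rw [setIntegral_pos_iff_support_of_nonneg_ae]
  · have hsub : Ioo x 1 \ ((fun y => x / y) '' zeros f) ⊆
        (Function.support fun t => betaDensity a b t * (f : ℝ → ℝ) (x / t) / t) ∩ Ioi 0 := by
      rintro t ⟨ht, htz⟩
      have ht0 : 0 < t := hx.1.trans ht.1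
      refine ⟨div_ne_zero (mul_ne_zero (betaDensity_pos hab ⟨ht0, ht.2⟩).ne' fun h => htz ?_)
        ht0.ne', ht0⟩
      have := hmem t ht.1 ht.2
      refine ⟨x / t, ⟨⟨hx.1.trans this.1, this.2⟩, h⟩, ?_⟩
      have := hx.1.ne'
      simp only
      field_simp
    refine lt_of_lt_of_le ?_ (measure_mono hsub)
    rw [measure_sdiff_null ((hfin.image _).measure_zero volume), Real.volume_Ioo]
    simpa using hx.2
  · refine (ae_restrict_iff' measurableSet_Ioi).2 (Eventually.of_forall fun t (ht : 0 < t) => ?_)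
    by_cases h1 : x < t ∧ t < 1
    · exact div_nonneg (mul_nonneg (betaDensity_nonneg hab t) (hf _ (hmem t h1.1 h1.2))) ht.le
    · refine le_of_eq ?_
      change 0 = betaDensity a b t * (f : ℝ → ℝ) (x / t) / t
      by_cases h2 : t < 1
      · rw [tame.zero_off f.2 fun h => h1 ⟨by rw [← div_lt_one ht]; exact h.2, h2⟩]; simp
      · rw [betaDensity_zero_off _ _ fun h => h2 h.2]; simp
  · exact (integrable_mellinConv_integrand (isKernel_betaDensity hab) f.2 hx.1).restrict

/-- Beta operators of large order diminish the number of sign changes. -/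
theorem encard_zeros_betaOp_le_card (a : ℝ) : ∀ (m : ℕ) (T : Finset ℝ), T.card = m →
    ∀ (b : ℝ) (f : tame), (m : ℝ) < b - a → (zeros f).Finite →
    (∀ x ∈ Ioo (0 : ℝ) 1, 0 ≤ (f : ℝ → ℝ) x * ∏ t ∈ T, (x - t)) →
    (zeros (betaOp a b f)).encard ≤ m := by
  intro m
  induction m with
  | zero =>
    intro T hT b f hab hfin hf
    rw [Finset.card_eq_zero.1 hT] at hf
    have : zeros (betaOp a b f) = ∅ := by
      refine eq_empty_of_forall_notMem fun x hx => (betaOp_pos (by simpa using hab) hfin hx.1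
        fun y hy => ?_).ne' hx.2
      simpa using hf y ⟨hx.1.1.trans hy.1, hy.2⟩
    simp [this]
  | succ m ih =>
    intro T hT b' f hab hfin hf
    obtain ⟨b, rfl⟩ : ∃ b, b' = b + 1 := ⟨b' - 1, by ring⟩
    have hTne : T.Nonempty := Finset.card_pos.1 (by omega)
    set t₀ := T.max' hTne with ht₀
    have ht₀T : t₀ ∈ T := T.max'_mem hTne
    have hc : (m : ℝ) < b - a := by push_cast at hab; linarith
    have hab' : a < b := by have : (0 : ℝ) ≤ m := m.cast_nonneg; linarith
    -- Multiplying f by (x - t₀)/x removes the largest sign change, while the order of the operator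
    -- drops by one.
    set f' : tame := f - t₀ • divX f with hf'
    have hf'x : ∀ x, x ∈ Ioo (0 : ℝ) 1 → (f' : ℝ → ℝ) x = (f : ℝ → ℝ) x * (x - t₀) / x := by
      intro x hx
      have := hx.1.ne'
      simp only [hf', Submodule.coe_sub, Submodule.coe_smul, Pi.sub_apply, Pi.smul_apply,
        smul_eq_mul, divX_apply]
      field_simp
    have hih := ih (T.erase t₀) (by rw [Finset.card_erase_of_mem ht₀T, hT]; rfl) b f' hc ?_ ?_
    rotate_left
    · refine (hfin.insert t₀).subset fun x hx => ?_
      have h := hx.2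
      rw [hf'x x hx.1, div_eq_zero_iff, mul_eq_zero] at h
      rcases h with (h | h) | h
      · exact Or.inr ⟨hx.1, h⟩
      · exact Or.inl (sub_eq_zero.1 h)
      · exact absurd h hx.1.1.ne'
    · intro x hx
      have h := hf x hx
      rw [← Finset.mul_prod_erase T _ ht₀T] at h
      rw [hf'x x hx, show (f : ℝ → ℝ) x * (x - t₀) / x * ∏ t ∈ T.erase t₀, (x - t) =
        ((f : ℝ → ℝ) x * ((x - t₀) * ∏ t ∈ T.erase t₀, (x - t))) / x by ring]
      exact div_nonneg h hx.1.le
    set u : tame := betaOp a (b + 1) f with hu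
    set q : tame := betaOp (a + 1) (b + 1) f with hq
    have huq : u = powOp a q := by rw [hu, betaOp_add_one hab'.le]; rfl
    have hK : ∀ x ∈ Ioo (0 : ℝ) 1, (betaOp a b f' : ℝ → ℝ) x =
        (q : ℝ → ℝ) x + (b - a) * (u : ℝ → ℝ) x - t₀ * ((q : ℝ → ℝ) x / x) := by
      intro x hx
      have h1 : x * (betaOp a b (divX f) : ℝ → ℝ) x = (q : ℝ → ℝ) x := by
        rw [← mulX_apply, ← Module.End.mul_apply, mulX_mul_betaOp, Module.End.mul_apply, mulX_divX]
      have h2 : (betaOp a b f : ℝ → ℝ) x = (q : ℝ → ℝ) x + (b - a) * (u : ℝ → ℝ) x := by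
        rw [betaOp_eq_add hab'.le]; rfl
      rw [hf', map_sub, map_smul, Submodule.coe_sub, Submodule.coe_smul, Pi.sub_apply,
        Pi.smul_apply, smul_eq_mul, h2, ← h1]
      have := hx.1.ne'
      field_simp
    -- To the right of every point of T the function f is nonnegative, so u is positive there; thus
    -- t₀ - z stays positive on the interval used for Rolle.
    have hlt : ∀ x ∈ zeros u, x < t₀ := by
      intro x hx
      by_contra! hxt
      refine (betaOp_pos (by linarith) hfin hx.1 fun y hy => ?_).ne' hx.2
      have hpos : 0 < ∏ t ∈ T, (y - t) := Finset.prod_pos fun t ht =>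
        sub_pos.2 ((T.le_max' t ht).trans_lt (hxt.trans_lt hy.1))
      exact nonneg_of_mul_nonneg_left (hf y ⟨hx.1.1.trans hy.1, hy.2⟩) hpos
    set I : ℝ → ℝ := fun x => ∫ t in x..1, t ^ (-a - 1) * (q : ℝ → ℝ) t with hI
    have hIu : ∀ x ∈ Ioo (0 : ℝ) 1, (u : ℝ → ℝ) x = x ^ a * I x := fun x hx => by
      rw [huq, powOp_apply a q hx]
    have hId : ∀ x ∈ Ioo (0 : ℝ) 1, HasDerivAt I (-(x ^ (-a - 1) * (q : ℝ → ℝ) x)) x := by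
      intro x hx
      have hcont : ContinuousOn (fun t => t ^ (-a - 1) * (q : ℝ → ℝ) t) (Ioo 0 1) :=
        ContinuousOn.mul (fun t ht => (Real.continuousAt_rpow_const t _
          (Or.inl ht.1.ne')).continuousWithinAt) (tame.continuousOn q.2)
      exact intervalIntegral.integral_hasDerivAt_left (intervalIntegrable_rpow_mul a q hx.1 one_pos)
        (hcont.stronglyMeasurableAtFilter isOpen_Ioo x hx)
        (hcont.continuousAt (isOpen_Ioo.mem_nhds hx))
    have hcard : (zeros u).encard ≤ (zeros (betaOp a b f')).encard + 1 := by
      refine encard_le_of_interleaved fun x hx y hy hxy => ?_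
      -- The exponent -(b - a) is chosen so that the derivative is a positive multiple of `betaOp a
      -- b f'`: up to the positive factor it equals (b-a)u - (t₀-z)q/z, which is the expression in
      -- `hK`.
      have hφ : ∀ z ∈ Icc x y, HasDerivAt (fun z => (t₀ - z) ^ (-(b - a)) * I z)
          ((t₀ - z) ^ (-(b - a) - 1) * z ^ (-a) * (betaOp a b f' : ℝ → ℝ) z) z := by
        intro z hz
        have hz1 : z ∈ Ioo (0 : ℝ) 1 := ⟨hx.1.1.trans_le hz.1, hz.2.trans_lt hy.1.2⟩
        have hzt : 0 < t₀ - z := sub_pos.2 (hz.2.trans_lt (hlt y hy))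
        have h1 : HasDerivAt (fun z => (t₀ - z) ^ (-(b - a)))
            (-1 * -(b - a) * (t₀ - z) ^ (-(b - a) - 1)) z :=
          ((hasDerivAt_id z).const_sub t₀).rpow_const (Or.inl hzt.ne')
        convert! h1.mul (hId z hz1) using 1
        rw [hK z hz1, hIu z hz1]
        have e1 : (t₀ - z) ^ (-(b - a)) = (t₀ - z) ^ (-(b - a) - 1) * (t₀ - z) := by
          rw [← Real.rpow_add_one hzt.ne', sub_add_cancel]
        have e2 : z ^ (-a - 1) = z ^ (-a) / z := by rw [Real.rpow_sub hz1.1, Real.rpow_one]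
        have e3 : z ^ (-a) * z ^ a = 1 := by rw [← Real.rpow_add hz1.1]; simp
        have hz0 := hz1.1.ne'
        rw [e1, e2]
        field_simp
        linear_combination ((b - a) * z * I z) * e3
      have hzero : ∀ z ∈ zeros u, I z = 0 := fun z hz => by
        have h := hz.2
        rw [hIu z hz.1] at h
        exact (mul_eq_zero.1 h).resolve_left (Real.rpow_pos_of_pos hz.1.1 _).ne'
      obtain ⟨z, hz, hz0⟩ := exists_hasDerivAt_eq_zero hxy
        (fun z hz => (hφ z hz).continuousAt.continuousWithinAt)
        (by rw [hzero x hx, hzero y hy, mul_zero, mul_zero])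
        fun z hz => hφ z ⟨hz.1.le, hz.2.le⟩
      have hz1 : z ∈ Ioo (0 : ℝ) 1 := ⟨hx.1.1.trans hz.1, hz.2.trans hy.1.2⟩
      have hzt : 0 < t₀ - z := sub_pos.2 (hz.2.trans (hlt y hy))
      refine ⟨z, ⟨hz1, (mul_eq_zero.1 hz0).resolve_left ?_⟩, hz⟩
      have := Real.rpow_pos_of_pos hzt (-(b - a) - 1)
      have := Real.rpow_pos_of_pos hz1.1 (-a)
      positivity
    refine hcard.trans ?_
    push_cast
    gcongr

/-- T collects the zeros at which f changes sign, and ε is the sign of f just left of u. The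
induction removes the largest zero t₀ and works on (0, t₀). -/
theorem exists_sign_pattern {f : ℝ → ℝ} : ∀ (m : ℕ) (S : Finset ℝ), S.card = m → ∀ u : ℝ,
    ContinuousOn f (Ioo 0 u) → (↑S ⊆ Ioo 0 u) → (∀ x ∈ Ioo 0 u, f x = 0 ↔ x ∈ S) →
    ∃ T ⊆ S, ∃ ε : ℝ, (ε = 1 ∨ ε = -1) ∧ ∀ x ∈ Ioo 0 u, 0 ≤ ε * f x * ∏ t ∈ T, (x - t) := by
  classical
  intro m
  induction m with
  | zero =>
    intro S hS u hf _ hz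
    rw [Finset.card_eq_zero.1 hS] at hz
    refine ⟨∅, Finset.empty_subset _, ?_⟩
    rcases pos_or_neg_of_ne_zero hf fun z hz' h => by simpa using (hz z hz').1 h with h | h
    · exact ⟨1, Or.inl rfl, fun x hx => by simpa using (h x hx).le⟩
    · exact ⟨-1, Or.inr rfl, fun x hx => by simpa using (h x hx).le⟩
  | succ m ih =>
    intro S hS u hf hSu hz
    have hSne : S.Nonempty := Finset.card_pos.1 (by omega)
    set t₀ := S.max' hSne with ht₀
    have ht₀S : t₀ ∈ S := S.max'_mem hSne
    have ht₀u := hSu ht₀S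
    have hlt : ∀ t ∈ S.erase t₀, t < t₀ := fun t ht =>
      lt_of_le_of_ne (S.le_max' t (Finset.mem_of_mem_erase ht)) (Finset.ne_of_mem_erase ht)
    obtain ⟨T, hTS, ε, hε, hT⟩ := ih (S.erase t₀)
      (by rw [Finset.card_erase_of_mem ht₀S, hS]; rfl) t₀
      (hf.mono (Ioo_subset_Ioo_right ht₀u.2.le))
      (fun t ht => ⟨(hSu (Finset.mem_of_mem_erase ht)).1, hlt t ht⟩)
      (fun x hx => by
        rw [hz x ⟨hx.1, hx.2.trans ht₀u.2⟩, Finset.mem_erase]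
        exact ⟨fun h => ⟨hx.2.ne, h⟩, fun h => h.2⟩)
    have hTpos : ∀ x, t₀ < x → 0 < ∏ t ∈ T, (x - t) := fun x hx =>
      Finset.prod_pos fun t ht => sub_pos.2 ((hlt t (hTS ht)).trans hx)
    have hft₀ : f t₀ = 0 := (hz t₀ ht₀u).2 ht₀S
    have hε2 : ε * ε = 1 := by rcases hε with rfl | rfl <;> norm_num
    have hsgn : (∀ x ∈ Ioo t₀ u, 0 < ε * f x) ∨ ∀ x ∈ Ioo t₀ u, ε * f x < 0 := by
      refine pos_or_neg_of_ne_zero (continuousOn_const.mul (hf.mono (Ioo_subset_Ioo_left ht₀u.1.le)))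
        fun z hz' h => ?_
      have hε0 : ε ≠ 0 := fun h => by simp [h] at hε2
      have := (hz z ⟨ht₀u.1.trans hz'.1, hz'.2⟩).1 ((mul_eq_zero.1 h).resolve_left hε0)
      exact not_lt.2 (S.le_max' z this) hz'.1
    have hT₀ : t₀ ∉ T := fun h => Finset.notMem_erase t₀ S (hTS h)
    rcases hsgn with h | h
    -- If the sign persists across t₀, T is kept; in the other case t₀ joins T and ε is flipped.
    · refine ⟨T, hTS.trans (Finset.erase_subset _ _), ε, hε, fun x hx => ?_⟩
      rcases lt_trichotomy x t₀ with hxt | rfl | hxt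
      · exact hT x ⟨hx.1, hxt⟩
      · simp [hft₀]
      · exact mul_nonneg (h x ⟨hxt, hx.2⟩).le (hTpos x hxt).le
    · refine ⟨insert t₀ T, Finset.insert_subset ht₀S (hTS.trans (Finset.erase_subset _ _)), -ε,
        by rcases hε with rfl | rfl <;> simp, fun x hx => ?_⟩
      rw [Finset.prod_insert hT₀]
      rcases lt_trichotomy x t₀ with hxt | rfl | hxt
      · have := mul_nonneg (hT x ⟨hx.1, hxt⟩) (sub_pos.2 hxt).le
        linarith
      · simp [hft₀]
      · have := mul_nonneg (mul_nonneg (neg_nonneg.2 (h x ⟨hxt, hx.2⟩).le) (hTpos x hxt).le)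
          (sub_pos.2 hxt).le
        linarith

theorem zeros_smul {c : ℝ} (hc : c ≠ 0) (f : tame) : zeros (c • f : tame) = zeros f := by
  ext x
  simp [mem_zeros, hc]

theorem encard_zeros_betaOp_le_of_lt {a b : ℝ} {f : tame} {m : ℕ} (hm : (m : ℝ) < b - a)
    (hf : (zeros f).encard ≤ m) : (zeros (betaOp a b f)).encard ≤ (zeros f).encard := by
  have hfin : (zeros f).Finite := finite_of_encard_le_coe hf
  obtain ⟨T, hTS, ε, hε, hT⟩ := exists_sign_pattern (f := f) _ hfin.toFinset rfl 1
    (tame.continuousOn f.2) (fun x hx => (hfin.mem_toFinset.1 hx).1)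
    (fun x hx => by rw [hfin.mem_toFinset, mem_zeros]; simp only [hx, true_and])
  have hε0 : ε ≠ 0 := by rcases hε with rfl | rfl <;> norm_num
  have hcard : (T.card : ℕ∞) ≤ (zeros f).encard := by
    rw [hfin.encard_eq_coe_toFinset_card]
    exact_mod_cast Finset.card_le_card hTS
  have hTm : T.card ≤ m := by exact_mod_cast hcard.trans hf
  have h := encard_zeros_betaOp_le_card a T.card T rfl b (ε • f)
    (lt_of_le_of_lt (by exact_mod_cast hTm) hm) (by rwa [zeros_smul hε0]) hT
  rw [map_smul, zeros_smul hε0] at h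
  exact h.trans hcard

/-- An operator of integer order m is a composition of m operators `powOp`, none of which adds a
zero. -/
theorem encard_zeros_betaOp_le_of_nat {a b : ℝ} (m : ℕ) (hm : b - a = m) (f : tame) :
    (zeros (betaOp a b f)).encard ≤ (zeros f).encard := by
  induction m generalizing b f with
  | zero =>
    obtain rfl : b = a := by simpa [sub_eq_zero] using hm
    rw [betaOp_self]; rfl
  | succ m ih =>
    obtain ⟨c, rfl⟩ : ∃ c, b = c + 1 := ⟨b - 1, by ring⟩
    have hc : c - a = m := by push_cast at hm; linarith
    have hac : a ≤ c := by have : (0 : ℝ) ≤ m := m.cast_nonneg; linarith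
    have h : betaOp a (c + 1) = betaOp a c * powOp c :=
      congrArg Subtype.val (betaEl_add_one hac)
    rw [h, Module.End.mul_apply]
    exact (ih hc _).trans (encard_zeros_powOp_le c f)

/-- The bound m survives every factor because zero counts never increase, so one threshold serves
all the orders. -/
theorem encard_zeros_prod_betaEl_le {ι : Type*} (s : Finset ι) (a b : ι → ℝ) (m : ℕ) (f : tame)
    (hab : ∀ i, (∃ n : ℕ, b i - a i = n) ∨ (m : ℝ) < b i - a i) (hf : (zeros f).encard ≤ m) :
    (zeros ((∏ i ∈ s, betaEl (a i) (b i)).1 f)).encard ≤ (zeros f).encard := by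
  classical
  induction s using Finset.induction_on with
  | empty => exact le_rfl
  | insert i s hi ih =>
    rw [Finset.prod_insert hi, betaAlg_mul_apply, coe_betaEl]
    refine le_trans ?_ ih
    rcases hab i with ⟨n, hn⟩ | h
    · exact encard_zeros_betaOp_le_of_nat n hn _
    · exact encard_zeros_betaOp_le_of_lt h (ih.trans hf)

/-! ### Solution spaces of Euler equations and powers of x. -/

/-- The solutions of the Euler equation `∏ (x d/dx - β) g = 0`, `β` running through the list,
described by iterated primitives. -/
def eulerSpaceList : List ℝ → Submodule ℝ tame
  | [] => ⊥
  | β :: L => Submodule.span ℝ {powFn β} ⊔ (eulerSpaceList L).map (powOp β)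

theorem mem_eulerSpaceList_cons {β : ℝ} {L : List ℝ} {g : tame} :
    g ∈ eulerSpaceList (β :: L) ↔ ∃ c : ℝ, ∃ h ∈ eulerSpaceList L,
      g = c • powFn β + powOp β h := by
  rw [eulerSpaceList, Submodule.mem_sup]
  constructor
  · rintro ⟨y, hy, z, hz, rfl⟩
    obtain ⟨c, rfl⟩ := Submodule.mem_span_singleton.1 hy
    obtain ⟨h, hh, rfl⟩ := Submodule.mem_map.1 hz
    exact ⟨c, h, hh, rfl⟩
  · rintro ⟨c, h, hh, rfl⟩
    exact ⟨_, Submodule.mem_span_singleton.2 ⟨c, rfl⟩, _, Submodule.mem_map_of_mem hh, rfl⟩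

theorem powFn_mem_eulerSpaceList_cons (β : ℝ) (L : List ℝ) :
    powFn β ∈ eulerSpaceList (β :: L) :=
  mem_eulerSpaceList_cons.2 ⟨1, 0, Submodule.zero_mem _, by simp⟩

theorem powOp_mem_eulerSpaceList_cons {β : ℝ} {L : List ℝ} {g : tame} (hg : g ∈ eulerSpaceList L) :
    powOp β g ∈ eulerSpaceList (β :: L) :=
  mem_eulerSpaceList_cons.2 ⟨0, g, hg, by simp⟩

theorem eulerSpaceList_cons_mono (β : ℝ) {L L' : List ℝ}
    (h : eulerSpaceList L ≤ eulerSpaceList L') :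
    eulerSpaceList (β :: L) ≤ eulerSpaceList (β :: L') :=
  sup_le_sup_left (Submodule.map_mono h) _

theorem powFn_mem_eulerSpaceList_cons_cons (β γ : ℝ) (L : List ℝ) :
    powFn β ∈ eulerSpaceList (γ :: β :: L) := by
  rw [show powFn β = powFn γ - (β - γ) • powOp γ (powFn β) by rw [smul_powOp_powFn]; abel]
  exact Submodule.sub_mem _ (powFn_mem_eulerSpaceList_cons _ _) (Submodule.smul_mem _ _
    (powOp_mem_eulerSpaceList_cons (powFn_mem_eulerSpaceList_cons _ _)))

/-- The Euler factors commute. The point to check is that x^β survives an outer exponent γ, which is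
the partial fraction identity. -/
theorem eulerSpaceList_swap (β γ : ℝ) (L : List ℝ) :
    eulerSpaceList (β :: γ :: L) ≤ eulerSpaceList (γ :: β :: L) := by
  intro g hg
  obtain ⟨c, g', hg', rfl⟩ := mem_eulerSpaceList_cons.1 hg
  obtain ⟨d, h, hh, rfl⟩ := mem_eulerSpaceList_cons.1 hg'
  have e : powOp β (powOp γ h) = powOp γ (powOp β h) :=
    LinearMap.congr_fun (betaOp_commute _ _ _ _).eq h
  rw [map_add, map_smul, powOp_powFn_comm, e]
  refine Submodule.add_mem _ (Submodule.smul_mem _ _ (powFn_mem_eulerSpaceList_cons_cons _ _ _))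
    (Submodule.add_mem _ (Submodule.smul_mem _ _ ?_) ?_)
  · exact powOp_mem_eulerSpaceList_cons (powFn_mem_eulerSpaceList_cons _ _)
  · exact powOp_mem_eulerSpaceList_cons (powOp_mem_eulerSpaceList_cons hh)

theorem eulerSpaceList_perm {L L' : List ℝ} (h : L.Perm L') :
    eulerSpaceList L = eulerSpaceList L' := by
  induction h with
  | nil => rfl
  | cons β _ ih =>
    exact le_antisymm (eulerSpaceList_cons_mono β ih.le) (eulerSpaceList_cons_mono β ih.ge)
  | swap β γ L => exact le_antisymm (eulerSpaceList_swap _ _ _) (eulerSpaceList_swap _ _ _)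
  | trans _ _ ih ih' => exact ih.trans ih'

theorem eulerSpaceList_le_cons (β : ℝ) (L : List ℝ) :
    eulerSpaceList L ≤ eulerSpaceList (β :: L) := by
  induction L with
  | nil => exact bot_le
  | cons γ L ih =>
    intro g hg
    obtain ⟨c, h, hh, rfl⟩ := mem_eulerSpaceList_cons.1 hg
    exact Submodule.add_mem _ (Submodule.smul_mem _ _ (powFn_mem_eulerSpaceList_cons_cons _ _ _))
      (eulerSpaceList_swap _ _ _ (powOp_mem_eulerSpaceList_cons (ih hh)))

theorem eulerSpaceList_sublist {L L' : List ℝ} (h : L.Sublist L') :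
    eulerSpaceList L ≤ eulerSpaceList L' := by
  induction h with
  | slnil => exact le_rfl
  | cons β _ ih => exact ih.trans (eulerSpaceList_le_cons β _)
  | cons_cons β _ ih => exact eulerSpaceList_cons_mono β ih

/-- Each exponent costs at most one zero by Rolle, and a single power has none. Repeated exponents,
which produce logarithms, need no separate treatment. -/
theorem encard_zeros_lt_length (L : List ℝ) {g : tame} (hg : g ∈ eulerSpaceList L) (h0 : g ≠ 0) :
    (zeros g).encard < (L.length : ℕ∞) := by
  induction L generalizing g with
  | nil => exact absurd ((Submodule.mem_bot ℝ).1 hg) h0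
  | cons β L ih =>
    obtain ⟨c, h, hh, rfl⟩ := mem_eulerSpaceList_cons.1 hg
    by_cases hz : h = 0
    · subst hz
      rw [map_zero, add_zero] at h0 ⊢
      have hc : c ≠ 0 := fun h => h0 (by rw [h, zero_smul])
      have : zeros (c • powFn β : tame) = ∅ := by
        rw [zeros_smul hc]
        refine eq_empty_of_forall_notMem fun x hx => ?_
        have h := hx.2
        rw [powFn_apply hx.1] at h
        exact (Real.rpow_pos_of_pos hx.1.1 β).ne' h
      rw [this, encard_empty, List.length_cons]
      exact_mod_cast Nat.succ_pos _
    · refine (encard_zeros_smul_powFn_add_le c β h).trans_lt ?_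
      have := ih hh hz
      rw [List.length_cons, Nat.cast_add, Nat.cast_one]
      exact (ENat.add_lt_add_iff_right ENat.one_ne_top).2 this

/-- `eulerSpaceList` as a function of the multiset of exponents. -/
def eulerSpace (m : Multiset ℝ) : Submodule ℝ tame := eulerSpaceList m.toList

theorem eulerSpace_mono {m m' : Multiset ℝ} (h : m ≤ m') : eulerSpace m ≤ eulerSpace m' := by
  have h' : m.toList.Subperm m'.toList := by
    rwa [← Multiset.coe_le, Multiset.coe_toList, Multiset.coe_toList]
  obtain ⟨L, hL, hL'⟩ := h'
  exact (eulerSpaceList_perm hL).ge.trans (eulerSpaceList_sublist hL')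

theorem eulerSpace_cons (β : ℝ) (m : Multiset ℝ) :
    eulerSpace (β ::ₘ m) = eulerSpaceList (β :: m.toList) :=
  eulerSpaceList_perm (by rw [← Multiset.coe_eq_coe, ← Multiset.cons_coe]; simp)

theorem one_sub_smul_powEl_mem (c β : ℝ) {m : Multiset ℝ} {g : tame} (hg : g ∈ eulerSpace m) :
    (1 - c • powEl β).1 g ∈ eulerSpace (β ::ₘ m) := by
  rw [eulerSpace_cons, betaAlg_sub_apply, betaAlg_smul_apply, betaAlg_one_apply]
  exact Submodule.sub_mem _ (eulerSpaceList_le_cons _ _ hg)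
    (Submodule.smul_mem _ _ (powOp_mem_eulerSpaceList_cons hg))

theorem prod_one_sub_mem {ι : Type*} (s : Finset ι) (c φ : ι → ℝ) {m : Multiset ℝ} {g : tame}
    (hg : g ∈ eulerSpace m) :
    (∏ i ∈ s, (1 - c i • powEl (φ i))).1 g ∈ eulerSpace (s.val.map φ + m) := by
  classical
  induction s using Finset.induction_on with
  | empty => simpa [betaAlg_one_apply] using hg
  | insert i s hi ih =>
    rw [Finset.prod_insert hi, betaAlg_mul_apply, Finset.insert_val_of_notMem hi,
      Multiset.map_cons, Multiset.cons_add]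
    exact one_sub_smul_powEl_mem _ _ ih

theorem one_sub_smul_powEl_powFn (c : ℝ) {β δ : ℝ} (h : δ ≠ β) :
    (1 - c • powEl β).1 (powFn δ) = (1 + c / (δ - β)) • powFn δ - (c / (δ - β)) • powFn β := by
  have hne : δ - β ≠ 0 := sub_ne_zero.2 h
  have e : c • powOp β (powFn δ) = (c / (δ - β)) • (powFn β - powFn δ) := by
    rw [← smul_powOp_powFn, smul_smul, div_mul_cancel₀ _ hne]
  rw [betaAlg_sub_apply, betaAlg_smul_apply, betaAlg_one_apply, coe_betaEl, e, smul_sub, add_smul,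
    one_smul]
  abel

/-- Each factor 1 - cP_φ is triangular on powers: it multiplies x^γ by 1 + c/(γ-φ) and adds a
multiple of x^φ. Only the coefficient of x^γ has to be known. -/
theorem exists_prod_one_sub_powFn {ι : Type*} (s : Finset ι) (c φ : ι → ℝ) (γ : ℝ)
    (hφ : InjOn φ s) (hγ : ∀ i ∈ s, γ ≠ φ i) :
    ∃ h ∈ Submodule.span ℝ (powFn '' (φ '' s)),
      (∏ i ∈ s, (1 - c i • powEl (φ i))).1 (powFn γ) =
        (∏ i ∈ s, (1 + c i / (γ - φ i))) • powFn γ + h := by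
  classical
  induction s using Finset.induction_on with
  | empty => exact ⟨0, Submodule.zero_mem _, by simp⟩
  | insert i s hi ih =>
    obtain ⟨h, hh, e⟩ := ih (hφ.mono (by simp)) fun j hj => hγ j (Finset.mem_insert_of_mem hj)
    have hi' : powFn (φ i) ∈ Submodule.span ℝ (powFn '' (φ '' (insert i s : Finset ι))) :=
      Submodule.subset_span ⟨_, ⟨i, by simp, rfl⟩, rfl⟩
    have hmap : (1 - c i • powEl (φ i)).1 h ∈
        Submodule.span ℝ (powFn '' (φ '' (insert i s : Finset ι))) := by
      refine (Submodule.map_span_le _ _ _).2 ?_ (Submodule.mem_map_of_mem hh)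
      rintro _ ⟨_, ⟨j, hj, rfl⟩, rfl⟩
      have hji : φ j ≠ φ i := fun h' => hi (by
        rw [← hφ (by simp [Finset.mem_coe.1 hj]) (by simp) h']; exact hj)
      rw [one_sub_smul_powEl_powFn _ hji]
      exact Submodule.sub_mem _ (Submodule.smul_mem _ _ (Submodule.subset_span
        ⟨_, ⟨j, by simp [Finset.mem_coe.1 hj], rfl⟩, rfl⟩)) (Submodule.smul_mem _ _ hi')
    set κ := ∏ j ∈ s, (1 + c j / (γ - φ j)) with hκ
    refine ⟨-(κ • (c i / (γ - φ i)) • powFn (φ i)) + (1 - c i • powEl (φ i)).1 h,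
      Submodule.add_mem _ (Submodule.neg_mem _ (Submodule.smul_mem _ _
        (Submodule.smul_mem _ _ hi'))) hmap, ?_⟩
    rw [Finset.prod_insert hi, betaAlg_mul_apply, e, map_add, map_smul,
      one_sub_smul_powEl_powFn _ (hγ i (by simp)), Finset.prod_insert hi, ← hκ, smul_sub,
      smul_smul, mul_comm κ]
    abel

/-- Sampled at the points 2^(-(m+1)), powers become eigenvectors of the shift on sequences, with
distinct eigenvalues 2^(-β). -/
theorem linearIndependent_powFn : LinearIndependent ℝ powFn := by
  let S : tame →ₗ[ℝ] (ℕ → ℝ) :=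
    { toFun := fun f m => (f : ℝ → ℝ) ((1 / 2) ^ (m + 1))
      map_add' := fun _ _ => rfl
      map_smul' := fun _ _ => rfl }
  refine LinearIndependent.of_comp S ?_
  have hS : ∀ β m, S (powFn β) m = ((1 / 2 : ℝ) ^ β) ^ (m + 1) := fun β m => by
    change (powFn β : ℝ → ℝ) _ = _
    rw [powFn_apply ⟨by positivity, pow_lt_one₀ (by norm_num) (by norm_num) (by omega)⟩,
      ← Real.rpow_natCast, ← Real.rpow_mul (by norm_num), mul_comm, Real.rpow_mul (by norm_num),
      Real.rpow_natCast]
  refine Module.End.eigenvectors_linearIndependent' (LinearMap.funLeft ℝ ℝ Nat.succ)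
    (fun β : ℝ => (1 / 2 : ℝ) ^ β) (fun β γ h => ?_) _ fun β => ⟨?_, fun h => ?_⟩
  · exact (Real.strictAnti_rpow_of_base_lt_one (by norm_num) (by norm_num)).injective h
  · rw [Module.End.mem_eigenspace_iff]
    ext m
    rw [LinearMap.funLeft_apply, Pi.smul_apply, smul_eq_mul, Function.comp_apply, hS, hS,
      Nat.succ_eq_add_one, pow_succ' _ (m + 1)]
  · have := congrFun h 0
    rw [Function.comp_apply, hS] at this
    have h2 : (0 : ℝ) < (1 / 2) ^ β := by positivity
    exact (pow_pos h2 _).ne' this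

/-! ### Polynomial combinations of the weights. -/

section Weights

variable {r : ℕ} (a b : Fin r → ℝ)

/-- The operator whose application to `x ^ (bⱼ + k)` corresponds to `x ^ k wⱼ`. -/
def shiftEl (k : ℕ) : betaAlg :=
  ∏ p ∈ Finset.univ.sigma fun _ : Fin r => Finset.range k,
    (1 - (b p.1 - a p.1) • powEl (b p.1 + p.2))

theorem shiftEl_succ (k : ℕ) :
    shiftEl a b (k + 1) = shiftEl a b k * ∏ i, (1 - (b i - a i) • powEl (b i + k)) := by
  simp only [shiftEl, Finset.prod_sigma, Finset.prod_range_succ, Finset.prod_mul_distrib]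

/-- Iterates `betaEl_shift`; the difference b_i - a_i is unchanged by the shift, so the same
constant appears at each level. -/
theorem prod_betaEl_shift (hab : ∀ j, a j ≤ b j) (k : ℕ) :
    ∏ i, betaEl (a i + k) (b i + k) = (∏ i, betaEl (a i) (b i)) * shiftEl a b k := by
  induction k with
  | zero => simp [shiftEl, Finset.prod_sigma]
  | succ k ih =>
    rw [shiftEl_succ, ← mul_assoc, ← ih, ← Finset.prod_mul_distrib]
    refine Finset.prod_congr rfl fun i _ => ?_
    have h := betaEl_shift (a := a i + k) (b := b i + k) (by linarith [hab i])
    rw [add_sub_add_right_eq_sub] at h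
    rw [← h, Nat.cast_add, Nat.cast_one, add_assoc, add_assoc]

theorem mulX_prod_betaEl {ι : Type*} (s : Finset ι) (a b : ι → ℝ) (f : tame) :
    mulX ((∏ i ∈ s, betaEl (a i) (b i)).1 f) =
      (∏ i ∈ s, betaEl (a i + 1) (b i + 1)).1 (mulX f) := by
  classical
  induction s using Finset.induction_on with
  | empty => rfl
  | insert i s hi ih =>
    rw [Finset.prod_insert hi, Finset.prod_insert hi, betaAlg_mul_apply, betaAlg_mul_apply, ← ih,
      coe_betaEl, coe_betaEl, ← Module.End.mul_apply, mulX_mul_betaOp, Module.End.mul_apply]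

theorem mulX_pow_prod_betaEl (β : ℝ) (k : ℕ) :
    (mulX ^ k) ((∏ i, betaEl (a i) (b i)).1 (powFn β)) =
      (∏ i, betaEl (a i + k) (b i + k)).1 (powFn (β + k)) := by
  induction k with
  | zero => simp
  | succ k ih =>
    rw [pow_succ', Module.End.mul_apply, ih, mulX_prod_betaEl, mulX_powFn]
    simp only [Nat.cast_add, Nat.cast_one, add_assoc]

theorem mulX_pow_apply (f : tame) (k : ℕ) (x : ℝ) :
    ((mulX ^ k) f : ℝ → ℝ) x = x ^ k * (f : ℝ → ℝ) x := by
  induction k with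
  | zero => simp
  | succ k ih => rw [pow_succ', Module.End.mul_apply, mulX_apply, ih, pow_succ']; ring

theorem pow_mul_weight (ha : ∀ j, -1 < a j) (hab : ∀ j, a j ≤ b j) (j : Fin r) (k : ℕ) (x : ℝ) :
    x ^ k * weight a b j x =
      ((∏ i, betaEl (a i) (b i)).1 ((shiftEl a b k).1 (powFn (b j + k))) : ℝ → ℝ) x := by
  rw [weight_eq a b ha hab, ← mulX_pow_apply, mulX_pow_prod_betaEl, prod_betaEl_shift a b hab,
    betaAlg_mul_apply]

/-- The Euler-type combination whose image under the common operator is `∑ⱼ Aⱼ wⱼ`. -/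
def eulerComb (n : Fin r → ℕ) (A : Fin r → ℝ[X]) : tame :=
  ∑ j, ∑ k ∈ Finset.range (n j), (A j).coeff k • (shiftEl a b k).1 (powFn (b j + k))

theorem eval_eq_sum_of_mem_degreeLT {p : ℝ[X]} {n : ℕ} (hp : p ∈ Polynomial.degreeLT ℝ n) (x : ℝ) :
    p.eval x = ∑ k ∈ Finset.range n, p.coeff k * x ^ k := by
  rcases eq_or_ne p 0 with rfl | h0
  · simp
  · exact Polynomial.eval_eq_sum_range' ((Polynomial.natDegree_lt_iff_degree_lt h0).2
      (Polynomial.mem_degreeLT.1 hp)) x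

theorem polyComb_weight_eq (ha : ∀ j, -1 < a j) (hab : ∀ j, a j ≤ b j) (n : Fin r → ℕ)
    (A : Fin r → ℝ[X]) (hA : ∀ j, A j ∈ Polynomial.degreeLT ℝ (n j)) :
    polyComb (weight a b) A = ((∏ i, betaEl (a i) (b i)).1 (eulerComb a b n A) : ℝ → ℝ) := by
  ext x
  simp only [eulerComb, map_sum, map_smul, Submodule.coe_sum, Finset.sum_apply, Submodule.coe_smul,
    Pi.smul_apply, smul_eq_mul, polyComb]
  refine Finset.sum_congr rfl fun j _ => ?_
  rw [eval_eq_sum_of_mem_degreeLT (hA j), Finset.sum_mul]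
  refine Finset.sum_congr rfl fun k _ => ?_
  rw [← pow_mul_weight a b ha hab, mul_assoc]

theorem eulerComb_mem (n : Fin r → ℕ) (hn : NearDiagonal n) (A : Fin r → ℝ[X]) :
    eulerComb a b n A ∈ eulerSpace ((Finset.univ.sigma fun i : Fin r => Finset.range (n i)).val.map
      fun p => b p.1 + p.2) := by
  classical
  refine Submodule.sum_mem _ fun j _ => Submodule.sum_mem _ fun k hk => Submodule.smul_mem _ _ ?_
  have h1 : powFn (b j + k) ∈ eulerSpace {b j + (k : ℝ)} := by
    rw [← Multiset.cons_zero, eulerSpace_cons]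
    exact powFn_mem_eulerSpaceList_cons _ _
  refine eulerSpace_mono ?_ (prod_one_sub_mem _ (fun p : (_ : Fin r) × ℕ => b p.1 - a p.1)
    (fun p => b p.1 + p.2) h1)
  have hnot : (⟨j, k⟩ : (_ : Fin r) × ℕ) ∉ Finset.univ.sigma fun _ : Fin r => Finset.range k := by
    simp
  rw [add_comm, Multiset.singleton_add]
  have e := Finset.insert_val_of_notMem hnot
  rw [show b j + (k : ℝ) = (fun p : (_ : Fin r) × ℕ => b p.1 + (p.2 : ℝ)) ⟨j, k⟩ from rfl,
    ← Multiset.map_cons (fun p : (_ : Fin r) × ℕ => b p.1 + (p.2 : ℝ)), ← e]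
  refine Multiset.map_le_map (Finset.val_le_iff.2 ?_)
  rw [Finset.mem_range] at hk
  refine Finset.insert_subset (by simpa using hk) fun p hp => ?_
  simp only [Finset.mem_sigma, Finset.mem_univ, Finset.mem_range, true_and] at hp ⊢
  -- Nearness to the diagonal enters here: l < k < n_j and n_j ≤ n_i + 1 give l < n_i, so every
  -- exponent b_i + l produced by x^k w_j is among the allowed ones.
  have := abs_le.1 (hn p.1 j)
  omega

theorem encard_zeros_polyComb_lt (ha : ∀ j, -1 < a j) (hab : ∀ j, a j ≤ b j) (n : Fin r → ℕ)
    (hn : NearDiagonal n)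
    (hc : ∀ j, (∃ m : ℕ, b j - a j = m) ∨ ((∑ i, n i : ℕ) : ℝ) - 1 < b j - a j)
    (A : Fin r → ℝ[X]) (hA : ∀ j, A j ∈ Polynomial.degreeLT ℝ (n j))
    (h0 : eulerComb a b n A ≠ 0) :
    (zeros (polyComb (weight a b) A)).encard < ((∑ j, n j : ℕ) : ℕ∞) := by
  have h1 := encard_zeros_lt_length _ (eulerComb_mem a b n hn A) h0
  rw [Multiset.length_toList, Multiset.card_map, Finset.card_val, Finset.card_sigma] at h1
  simp only [Finset.card_range] at h1
  have hN : 0 < ∑ j, n j := by exact_mod_cast pos_of_gt h1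
  rw [polyComb_weight_eq a b ha hab n A hA]
  -- The Euler combination has at most |n| - 1 zeros, exactly the threshold that the non-integer
  -- orders exceed.
  refine (encard_zeros_prod_betaEl_le _ a b (∑ j, n j - 1) _ ?_ ?_).trans_lt h1
  · rwa [Nat.cast_sub hN, Nat.cast_one]
  · obtain ⟨N, hN'⟩ : ∃ N, ∑ j, n j = N + 1 := ⟨_, (Nat.succ_pred_eq_of_pos hN).symm⟩
    rw [hN'] at h1 ⊢
    exact Order.le_of_lt_add_one (by simpa using h1)

theorem exists_shiftEl_powFn
    (hinj : Function.Injective fun p : (_ : Fin r) × ℕ => b p.1 + (p.2 : ℝ)) (j : Fin r) (k : ℕ) :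
    ∃ h ∈ Submodule.span ℝ (powFn '' ((fun p : (_ : Fin r) × ℕ => b p.1 + (p.2 : ℝ)) ''
      (Finset.univ.sigma fun _ : Fin r => Finset.range k : Finset ((_ : Fin r) × ℕ)))),
      (shiftEl a b k).1 (powFn (b j + k)) =
        (∏ p ∈ Finset.univ.sigma fun _ : Fin r => Finset.range k,
          (1 + (b p.1 - a p.1) / (b j + k - (b p.1 + p.2)))) • powFn (b j + k) + h := by
  have h := exists_prod_one_sub_powFn (Finset.univ.sigma fun _ : Fin r => Finset.range k)
    (fun p : (_ : Fin r) × ℕ => b p.1 - a p.1) (fun p => b p.1 + (p.2 : ℝ)) (b j + k) hinj.injOn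
    fun p hp h => by
      obtain rfl : (⟨j, k⟩ : (_ : Fin r) × ℕ) = p := hinj h
      simp at hp
  rw [shiftEl]
  exact h

/-- Let K be the largest degree, attained at j₀. The exponent b_{j₀} + K arises only from the term
(j₀, K): every other term contributes its own exponent and exponents b_i + l with l < K, and all
these are distinct. Its coefficient is the leading coefficient times factors that do not vanish. -/
theorem eulerComb_ne_zero (hc : ∀ j, ∃ m : ℕ, b j - a j = m)
    (hb : ∀ i j, i ≠ j → ∀ m : ℤ, b i - b j ≠ m) (n : Fin r → ℕ) (A : Fin r → ℝ[X])
    (hA : ∀ j, A j ∈ Polynomial.degreeLT ℝ (n j)) (h0 : A ≠ 0) : eulerComb a b n A ≠ 0 := by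
  classical
  set φ : (_ : Fin r) × ℕ → ℝ := fun p => b p.1 + p.2 with hφ
  have hinj : Function.Injective φ := by
    rintro ⟨i, l⟩ ⟨j, k⟩ h
    simp only [hφ] at h
    have hij : i = j := by
      by_contra hij
      exact hb i j hij (k - l) (by push_cast; linarith)
    subst hij
    simpa using h
  have hne : ∃ j, A j ≠ 0 := by
    by_contra! h
    exact h0 (funext h)
  obtain ⟨j₀, hj₀, hmax⟩ := Finset.exists_max_image (Finset.univ.filter fun j => A j ≠ 0)
    (fun j => (A j).natDegree) (by obtain ⟨j, hj⟩ := hne; exact ⟨j, by simpa using hj⟩)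
  simp only [Finset.mem_filter, Finset.mem_univ, true_and] at hj₀ hmax
  set K := (A j₀).natDegree with hK
  have hKn : K < n j₀ := (Polynomial.natDegree_lt_iff_degree_lt hj₀).2
    (Polynomial.mem_degreeLT.1 (hA j₀))
  have hcoeff : ∀ j k, K < k → (A j).coeff k = 0 := fun j k hk => by
    by_cases hj : A j = 0
    · simp [hj]
    · exact Polynomial.coeff_eq_zero_of_natDegree_lt ((hmax j hj).trans_lt hk)
  set V := Submodule.span ℝ (powFn '' (φ '' {p | p ≠ ⟨j₀, K⟩})) with hV
  have hnot : powFn (φ ⟨j₀, K⟩) ∉ V := by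
    refine linearIndependent_powFn.notMem_span_image ?_
    rintro ⟨p, hp, hpe⟩
    exact hp (hinj hpe)
  have hsub : ∀ k, k ≤ K → Submodule.span ℝ (powFn '' (φ ''
      (Finset.univ.sigma fun _ : Fin r => Finset.range k : Finset ((_ : Fin r) × ℕ)))) ≤ V := by
    intro k hk
    refine Submodule.span_mono (image_mono (image_mono fun p hp => ?_))
    simp only [Finset.coe_sigma, Set.mem_sigma_iff, Finset.mem_coe, Finset.mem_range] at hp
    rintro rfl
    exact absurd hp.2 (by simpa using hk)
  have hG := exists_shiftEl_powFn a b hinj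
  intro hzero
  have hrest : ∀ j k, (⟨j, k⟩ : (_ : Fin r) × ℕ) ≠ ⟨j₀, K⟩ →
      (A j).coeff k • (shiftEl a b k).1 (powFn (b j + k)) ∈ V := by
    intro j k hjk
    rcases lt_or_ge K k with hk | hk
    · rw [hcoeff j k hk, zero_smul]; exact Submodule.zero_mem _
    · obtain ⟨h, hh, e⟩ := hG j k
      rw [e]
      exact Submodule.smul_mem _ _ (Submodule.add_mem _ (Submodule.smul_mem _ _
        (Submodule.subset_span (mem_image_of_mem powFn ⟨⟨j, k⟩, hjk, rfl⟩))) (hsub k hk hh))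
  have hmain : (A j₀).coeff K • (shiftEl a b K).1 (powFn (b j₀ + K)) ∈ V := by
    rw [eulerComb, Finset.sum_sigma' Finset.univ (fun j => Finset.range (n j))
      (fun j k => (A j).coeff k • (shiftEl a b k).1 (powFn (b j + k))),
      ← Finset.add_sum_erase _ _ (show (⟨j₀, K⟩ : (_ : Fin r) × ℕ) ∈
        Finset.univ.sigma fun j => Finset.range (n j) by simpa using hKn)] at hzero
    rw [eq_neg_of_add_eq_zero_left hzero]
    refine Submodule.neg_mem _ (Submodule.sum_mem _ fun p hp => hrest p.1 p.2 ?_)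
    exact Finset.ne_of_mem_erase hp
  obtain ⟨h, hh, e⟩ := hG j₀ K
  rw [e, smul_add] at hmain
  have h1 := (Submodule.add_mem_iff_left V (Submodule.smul_mem _ _ (hsub K le_rfl hh))).1 hmain
  rw [smul_smul] at h1
  refine hnot ((Submodule.smul_mem_iff V ?_).1 h1)
  refine mul_ne_zero (by simpa [hK] using hj₀) (Finset.prod_ne_zero_iff.2 ?_)
  rintro ⟨i, l⟩ hp
  simp only [Finset.mem_sigma, Finset.mem_univ, Finset.mem_range, true_and] at hp
  have hlK : (l : ℝ) < K := by exact_mod_cast hp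
  have hd : b j₀ + K - φ ⟨i, l⟩ ≠ 0 := fun h => by
    have := hinj (show φ ⟨j₀, K⟩ = φ ⟨i, l⟩ from sub_eq_zero.1 h)
    simp only [Sigma.mk.injEq, heq_eq_eq] at this
    omega
  obtain ⟨m, hm⟩ := hc i
  -- The numerator is b_{j₀} - b_i + K - l + m with m = b_i - a_i. For i = j₀ it is positive since l
  -- < K; for i ≠ j₀ its vanishing would make b_i - b_{j₀} an integer.
  rw [← div_self hd, ← add_div]
  refine div_ne_zero (fun h => ?_) hd
  simp only [hφ, hm] at h
  by_cases hij : i = j₀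
  · subst hij
    have : (0 : ℝ) ≤ m := m.cast_nonneg
    linarith
  · exact hb i j₀ hij (K - l + m) (by push_cast; linarith)

end Weights

end

end JacobiLike

theorem mainTheorem7 (r : ℕ) (a b : Fin r → ℝ)
    (ha : ∀ j, -1 < a j) (hab : ∀ j, a j ≤ b j) :
    (∀ n : Fin r → ℕ, JacobiLike.NearDiagonal n →
      (∀ j, (∃ m : ℕ, b j - a j = m) ∨ ((∑ i, n i : ℕ) : ℝ) - 1 < b j - a j) →
      ((∀ i j, i ≠ j → ∀ m : ℤ, b i - b j ≠ m) ∨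
        ∃ J, ((∑ i, n i : ℕ) : ℝ) - (n J : ℝ) < b J - a J) →
      JacobiLike.IsATSystem (JacobiLike.weight a b) (Set.Ioo 0 1) n) ∧
    ((∀ j, ∃ m : ℕ, b j - a j = m) →
      (∀ i j, i ≠ j → ∀ m : ℤ, b i - b j ≠ m) →
      ∀ n : Fin r → ℕ, JacobiLike.NearDiagonal n →
        JacobiLike.IsATSystem (JacobiLike.weight a b) (Set.Ioo 0 1) n ∧
        JacobiLike.IsIndependentSystem (JacobiLike.weight a b) (Set.Ioo 0 1) n) := by
  have hAT : ∀ n : Fin r → ℕ, JacobiLike.NearDiagonal n →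
      (∀ j, (∃ m : ℕ, b j - a j = m) ∨ ((∑ i, n i : ℕ) : ℝ) - 1 < b j - a j) →
      JacobiLike.IsATSystem (JacobiLike.weight a b) (Set.Ioo 0 1) n := by
    rintro n hn hc A hA ⟨x, -, hx⟩
    refine JacobiLike.encard_zeros_polyComb_lt a b ha hab n hn hc A hA fun h => hx ?_
    rw [JacobiLike.polyComb_weight_eq a b ha hab n A hA, h, map_zero]
    rfl
  refine ⟨fun n hn hc _ => hAT n hn hc, fun hc hb n hn =>
    ⟨hAT n hn fun j => Or.inl (hc j), fun A hA h0 => ?_⟩⟩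
  have h := JacobiLike.encard_zeros_polyComb_lt a b ha hab n hn (fun j => Or.inl (hc j)) A hA
    (JacobiLike.eulerComb_ne_zero a b hc hb n A hA h0)
  -- The zero bound already holds once the Euler combination is nonzero, and a function vanishing on
  -- all of (0, 1) would have infinitely many zeros.
  by_contra! hz
  have hfin : (JacobiLike.zeros (JacobiLike.polyComb (JacobiLike.weight a b) A)).Finite :=
    Set.finite_of_encard_le_coe h.le
  exact Set.Ioo_infinite (zero_lt_one' ℝ) (hfin.subset fun x hx => ⟨hx, hz x hx⟩)
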